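/- Let $SYT_n$ be the set of standard Young tableaux with $n$ cells. For $T\in SYT_n$ let $\mathcal Y_T\subset S_n$ be its Knuth class, i.e. the set of permutations whose Robinson–Schensted insertion tableau is $T$. Let $\le_{weak}$ be Melnikov's weak order on $SYT_n$: the transitive closure of the relation that holds between $S$ and $T$ if there are $\sigma\in\mathcal Y_S$ and $\tau\in\mathcal Y_T$ with $\sigma\le\tau$ in the right weak (Bruhat) order on $S_n$, which is itself generated by $u\le u s_i$ whenever $s_i=(i,i+1)$ and $\ell(us_i)=\ell(u)+1$. For $k\le n$ and $R\in SYT_k$ let $SYT_n^R$ be the set of $T\in SYT_n$ whose inner tableau $T_{[1,k]}$ (the part of $T$ filled with $1,\dots,k$) equals $R$, with the order induced by $\le_{weak}$. For $R,R'\in SYT_k$ of the same shape let $\mathcal V_{[R,R']}:SYT_n^R\to SYT_n^{R'}$ be the inner tableau translation map, which replaces the inner tableau $R$ of $T$ with $R'$. **Proposition.** Suppose that $R\in SYT_k$ has exactly two rows and that $R'\in SYT_k$ has the same shape as $R$. Let $S,T\in SYT_n^R$. 1. If $S\lessdot T$ is a covering relation in $SYT_n^R$, then $\mathcal V_{[R,R']}(S)\lessdot\mathcal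 V_{[R,R']}(T)$ is a covering relation in $SYT_n^{R'}$. 2. If $S\lessdot T$ is a covering relation in $SYT_n$, then $\mathcal V_{[R,R']}(S)\lessdot\mathcal V_{[R,R']}(T)$ is a covering relation in $SYT_n$. 3. If $S\le_{weak}T$, then $\mathcal V_{[R,R']}(S)\le_{weak}\mathcal V_{[R,R']}(T)$. (Here $S\lessdot T$ means that $S< T$, i.e. $S\le_{weak} T$ and $S\ne T$, and that no $Q$ in the set in question satisfies $S<Q<T$.) Thus the inner tableau translation property holds for two-row inner tableaux. -/

import Mathlib

/-- A standard Young tableau with `n` cells.  Cells are pairs `(row, column)`, counted from `0`;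
the cells are filled bijectively with `1, …, n`, increasing along rows and down columns.
Outside its shape, `entry` is `0`. -/
@[ext]
structure SYT (n : ℕ) where
  shape : YoungDiagram
  entry : ℕ → ℕ → ℕ
  entry_eq_zero : ∀ i j, (i, j) ∉ shape → entry i j = 0
  bijOn : Set.BijOn (fun c : ℕ × ℕ => entry c.1 c.2) {c | c ∈ shape} (Set.Icc 1 n)
  row_lt : ∀ i j₁ j₂, j₁ < j₂ → (i, j₂) ∈ shape → entry i j₁ < entry i j₂
  col_lt : ∀ i₁ i₂ j, i₁ < i₂ → (i₂, j) ∈ shape → entry i₁ j < entry i₂ j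

namespace SYT

variable {n k : ℕ}

/-- The list of the rows of `T`, from top to bottom, each read from left to right. -/
def rows (T : SYT n) : List (List ℕ) :=
  (List.range (T.shape.colLen 0)).map fun i => (List.range (T.shape.rowLen i)).map (T.entry i)

/-- The number of (nonempty) rows of `T`. -/
def numRows (T : SYT n) : ℕ := T.shape.colLen 0

theorem entry_pos (T : SYT n) {i j : ℕ} (h : (i, j) ∈ T.shape) : 1 ≤ T.entry i j :=
  (T.bijOn.mapsTo (show ((i, j) : ℕ × ℕ) ∈ {c | c ∈ T.shape} from h)).1

theorem entry_le (T : SYT n) {i j : ℕ} (h : (i, j) ∈ T.shape) : T.entry i j ≤ n :=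
  (T.bijOn.mapsTo (show ((i, j) : ℕ × ℕ) ∈ {c | c ∈ T.shape} from h)).2

theorem entry_mono (T : SYT n) {i₁ i₂ j₁ j₂ : ℕ} (hi : i₁ ≤ i₂) (hj : j₁ ≤ j₂)
    (h : (i₂, j₂) ∈ T.shape) : T.entry i₁ j₁ ≤ T.entry i₂ j₂ := by
  have h' : (i₂, j₁) ∈ T.shape := T.shape.up_left_mem le_rfl hj h
  have a : T.entry i₁ j₁ ≤ T.entry i₂ j₁ := by
    rcases hi.eq_or_lt with rfl | hi
    · exact le_rfl
    · exact (T.col_lt _ _ _ hi h').le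
  have b : T.entry i₂ j₁ ≤ T.entry i₂ j₂ := by
    rcases hj.eq_or_lt with rfl | hj
    · exact le_rfl
    · exact (T.row_lt _ _ _ hj h).le
  exact a.trans b

/-- The diagram formed by the cells of `T` with entries at most `k`. -/
def innerShape (T : SYT n) (k : ℕ) : YoungDiagram where
  cells := T.shape.cells.filter fun c => T.entry c.1 c.2 ≤ k
  isLowerSet := by
    rintro ⟨i₂, j₂⟩ ⟨i₁, j₁⟩ hle hmem
    simp only [Finset.coe_filter, YoungDiagram.mem_cells, Set.mem_ofPred_eq] at hmem ⊢
    exact ⟨T.shape.up_left_mem hle.1 hle.2 hmem.1,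
      (T.entry_mono hle.1 hle.2 hmem.1).trans hmem.2⟩

theorem mem_innerShape (T : SYT n) (k : ℕ) {i j : ℕ} :
    (i, j) ∈ T.innerShape k ↔ (i, j) ∈ T.shape ∧ T.entry i j ≤ k := by
  rw [← YoungDiagram.mem_cells]
  simp [innerShape]

/-- The inner tableau `T_{[1,k]}`: the part of `T` formed by the entries `1, …, k`. -/
def inner (T : SYT n) (k : ℕ) (hk : k ≤ n) : SYT k where
  shape := T.innerShape k
  entry i j := if (i, j) ∈ T.innerShape k then T.entry i j else 0
  entry_eq_zero i j h := if_neg h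
  bijOn := by
    refine ⟨?_, ?_, ?_⟩
    · rintro ⟨i, j⟩ h
      have h' : (i, j) ∈ T.innerShape k := h
      simp only [if_pos h']
      exact ⟨T.entry_pos ((T.mem_innerShape k).1 h').1, ((T.mem_innerShape k).1 h').2⟩
    · rintro ⟨i, j⟩ h ⟨i', j'⟩ h' heq
      have h1 : (i, j) ∈ T.innerShape k := h
      have h2 : (i', j') ∈ T.innerShape k := h'
      simp only [if_pos h1, if_pos h2] at heq
      exact T.bijOn.injOn ((T.mem_innerShape k).1 h1).1 ((T.mem_innerShape k).1 h2).1 heq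
    · rintro m ⟨hm1, hm2⟩
      obtain ⟨⟨i, j⟩, hc, hm⟩ := T.bijOn.surjOn (show m ∈ Set.Icc 1 n from ⟨hm1, hm2.trans hk⟩)
      have hc' : (i, j) ∈ T.innerShape k := (T.mem_innerShape k).2 ⟨hc, hm.le.trans hm2⟩
      exact ⟨(i, j), hc', (if_pos hc').trans hm⟩
  row_lt i j₁ j₂ hj h := by
    rw [if_pos h, if_pos (YoungDiagram.up_left_mem _ le_rfl hj.le h)]
    exact T.row_lt _ _ _ hj ((T.mem_innerShape k).1 h).1
  col_lt i₁ i₂ j hi h := by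
    rw [if_pos h, if_pos (YoungDiagram.up_left_mem _ hi.le le_rfl h)]
    exact T.col_lt _ _ _ hi ((T.mem_innerShape k).1 h).1

/-- `SYT_n^R`: the standard Young tableaux `T` with `n` cells such that `T_{[1,k]} = R`. -/
abbrev WithInner (hk : k ≤ n) (R : SYT k) : Type := {T : SYT n // T.inner k hk = R}

theorem WithInner.mem_iff {hk : k ≤ n} {R : SYT k} (T : WithInner hk R) {i j : ℕ} :
    (i, j) ∈ R.shape ↔ (i, j) ∈ T.1.shape ∧ T.1.entry i j ≤ k := by
  obtain ⟨T, rfl⟩ := T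
  exact T.mem_innerShape k

/-- The tableau obtained from `T` (with inner tableau `R`) by replacing `R` with a tableau `R'`
of the same shape. -/
def replaceInner {hk : k ≤ n} {R R' : SYT k} (hsh : R.shape = R'.shape) (T : WithInner hk R) :
    SYT n where
  shape := T.1.shape
  entry i j := if (i, j) ∈ R.shape then R'.entry i j else T.1.entry i j
  entry_eq_zero i j h := by
    rw [if_neg fun h' => h (T.mem_iff.1 h').1]
    exact T.1.entry_eq_zero i j h
  bijOn := by
    refine ⟨?_, ?_, ?_⟩
    · rintro ⟨i, j⟩ h
      by_cases hR : (i, j) ∈ R.shape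
      · simp only [if_pos hR]
        rw [hsh] at hR
        exact ⟨R'.entry_pos hR, (R'.entry_le hR).trans hk⟩
      · simp only [if_neg hR]
        exact ⟨T.1.entry_pos h, T.1.entry_le h⟩
    · rintro ⟨i, j⟩ h ⟨i', j'⟩ h' heq
      by_cases hR : (i, j) ∈ R.shape <;> by_cases hR' : (i', j') ∈ R.shape
      · simp only [if_pos hR, if_pos hR'] at heq
        rw [hsh] at hR hR'
        exact R'.bijOn.injOn hR hR' heq
      · simp only [if_pos hR, if_neg hR'] at heq
        rw [hsh] at hR
        exact absurd (T.mem_iff.2 ⟨h', heq ▸ R'.entry_le hR⟩) hR'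
      · simp only [if_neg hR, if_pos hR'] at heq
        rw [hsh] at hR'
        exact absurd (T.mem_iff.2 ⟨h, heq ▸ R'.entry_le hR'⟩) hR
      · simp only [if_neg hR, if_neg hR'] at heq
        exact T.1.bijOn.injOn h h' heq
    · rintro m ⟨hm1, hm2⟩
      by_cases hm : m ≤ k
      · obtain ⟨⟨i, j⟩, hc, he⟩ := R'.bijOn.surjOn (show m ∈ Set.Icc 1 k from ⟨hm1, hm⟩)
        have hc' : (i, j) ∈ R.shape := hsh ▸ hc
        exact ⟨(i, j), (T.mem_iff.1 hc').1, (if_pos hc').trans he⟩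
      · obtain ⟨⟨i, j⟩, hc, he⟩ := T.1.bijOn.surjOn (show m ∈ Set.Icc 1 n from ⟨hm1, hm2⟩)
        have hc' : (i, j) ∉ R.shape := fun h => hm (he ▸ (T.mem_iff.1 h).2)
        exact ⟨(i, j), hc, (if_neg hc').trans he⟩
  row_lt i j₁ j₂ hj h := by
    by_cases h2 : (i, j₂) ∈ R.shape
    · have h1 : (i, j₁) ∈ R.shape := R.shape.up_left_mem le_rfl hj.le h2
      rw [if_pos h1, if_pos h2]
      exact R'.row_lt _ _ _ hj (hsh ▸ h2)
    · rw [if_neg h2]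
      by_cases h1 : (i, j₁) ∈ R.shape
      · rw [if_pos h1]
        exact (R'.entry_le (hsh ▸ h1)).trans_lt
          (not_le.1 fun hle => h2 (T.mem_iff.2 ⟨h, hle⟩))
      · rw [if_neg h1]
        exact T.1.row_lt _ _ _ hj h
  col_lt i₁ i₂ j hi h := by
    by_cases h2 : (i₂, j) ∈ R.shape
    · have h1 : (i₁, j) ∈ R.shape := R.shape.up_left_mem hi.le le_rfl h2
      rw [if_pos h1, if_pos h2]
      exact R'.col_lt _ _ _ hi (hsh ▸ h2)
    · rw [if_neg h2]
      by_cases h1 : (i₁, j) ∈ R.shape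
      · rw [if_pos h1]
        exact (R'.entry_le (hsh ▸ h1)).trans_lt
          (not_le.1 fun hle => h2 (T.mem_iff.2 ⟨h, hle⟩))
      · rw [if_neg h1]
        exact T.1.col_lt _ _ _ hi h

theorem inner_replaceInner {hk : k ≤ n} {R R' : SYT k} (hsh : R.shape = R'.shape)
    (T : WithInner hk R) : (replaceInner hsh T).inner k hk = R' := by
  have key : ∀ i j, (i, j) ∈ (replaceInner hsh T).innerShape k ↔ (i, j) ∈ R'.shape := by
    intro i j
    rw [mem_innerShape]
    by_cases h : (i, j) ∈ R.shape
    · have h' : (i, j) ∈ R'.shape := hsh ▸ h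
      simp only [replaceInner, if_pos h, h', iff_true]
      exact ⟨(T.mem_iff.1 h).1, R'.entry_le h'⟩
    · have h' : (i, j) ∉ R'.shape := hsh ▸ h
      simp only [replaceInner, if_neg h, h', iff_false]
      exact fun hh => h (T.mem_iff.2 hh)
  apply SYT.ext
  · apply SetLike.ext
    rintro ⟨i, j⟩
    exact key i j
  · funext i j
    change (if (i, j) ∈ (replaceInner hsh T).innerShape k
      then (replaceInner hsh T).entry i j else 0) = R'.entry i j
    by_cases h : (i, j) ∈ R'.shape
    · rw [if_pos ((key i j).2 h)]
      exact if_pos (hsh ▸ h)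
    · rw [if_neg (mt (key i j).1 h), R'.entry_eq_zero i j h]

/-- The inner tableau translation map `V_{[R,R']} : SYT_n^R → SYT_n^{R'}`, for tableaux `R` and
`R'` of the same shape: it replaces the inner tableau `R` with `R'`. -/
def innerTranslation {hk : k ≤ n} {R R' : SYT k} (hsh : R.shape = R'.shape)
    (T : WithInner hk R) : WithInner hk R' :=
  ⟨replaceInner hsh T, inner_replaceInner hsh T⟩

end SYT

/-- Insertion of `x` into an increasing row: `x` is put at the end if no entry exceeds `x`, and
otherwise it replaces the smallest entry exceeding `x`.  The second component is the entry that
has been replaced, if any. -/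
def rowInsert (x : ℕ) : List ℕ → List ℕ × Option ℕ
  | [] => ([x], none)
  | a :: l => if x < a then (x :: l, some a) else (a :: (rowInsert x l).1, (rowInsert x l).2)

/-- Schensted insertion of `x` into a tableau, given as the list of its rows: the entry replaced
in a row is inserted into the next row. -/
def tableauInsert (x : ℕ) : List (List ℕ) → List (List ℕ)
  | [] => [[x]]
  | r :: rs =>
    match (rowInsert x r).2 with
    | none => (rowInsert x r).1 :: rs
    | some y => (rowInsert x r).1 :: tableauInsert y rs

/-- The insertion tableau of a word, as the list of its rows. -/
def insertionTableau (w : List ℕ) : List (List ℕ) :=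
  w.foldl (fun P x => tableauInsert x P) []

namespace SYT

variable {n : ℕ}

/-- The one-line notation `w_1 w_2 ⋯ w_n` of a permutation, with letters `1, …, n`. -/
def oneLine (w : Equiv.Perm (Fin n)) : List ℕ := List.ofFn fun i => (w i : ℕ) + 1

/-- The Knuth class of `T`: the permutations whose insertion tableau is `T`. -/
def knuthClass (T : SYT n) : Set (Equiv.Perm (Fin n)) :=
  {w | insertionTableau (oneLine w) = T.rows}

/-- The adjacent transposition exchanging the positions `i` and `i + 1` (counted from `0`). -/
def adjSwap (i : ℕ) (h : i + 1 < n) : Equiv.Perm (Fin n) :=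
  Equiv.swap ⟨i, (Nat.lt_succ_self i).trans h⟩ ⟨i + 1, h⟩

/-- The length of a permutation: the least number of factors in an expression of it as a product
of adjacent transpositions. -/
noncomputable def permLength (w : Equiv.Perm (Fin n)) : ℕ :=
  sInf {m | ∃ l : List (Equiv.Perm (Fin n)),
    (∀ s ∈ l, ∃ (i : ℕ) (h : i + 1 < n), s = adjSwap i h) ∧ l.prod = w ∧ l.length = m}

/-- The right weak order on `S_n`: the reflexive and transitive closure of the relation
`u ≤ u * s_i` where `s_i` is an adjacent transposition with `ℓ (u * s_i) = ℓ u + 1`. -/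
def permWeakLE : Equiv.Perm (Fin n) → Equiv.Perm (Fin n) → Prop :=
  Relation.ReflTransGen fun u w =>
    ∃ (i : ℕ) (h : i + 1 < n), w = u * adjSwap i h ∧ permLength w = permLength u + 1

/-- Melnikov's weak order on `SYT_n`: the transitive closure of the relation that holds between
`S` and `T` if some `σ` in the Knuth class of `S` and some `τ` in the Knuth class of `T` satisfy
`σ ≤ τ` in the right weak order. -/
instance : LE (SYT n) where
  le := Relation.ReflTransGen fun S T => ∃ σ ∈ S.knuthClass, ∃ τ ∈ T.knuthClass, permWeakLE σ τ

/-- The strict weak order.  The covering relation `⋖` of the weak order is Mathlib's `CovBy` for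
this strict order: `S ⋖ T` if `S < T` and there is no `Q` with `S < Q` and `Q < T`. -/
instance : LT (SYT n) where
  lt S T := S ≤ T ∧ S ≠ T

end SYT

/-! ### Row insertion -/

/-! The weak order is generated by exchanging adjacent letters `a < b` of a word to `b a`
(`SYT.le_iff`). Two things are monotone under such an exchange: the number of entries below any
bound in the first row of the insertion tableau does not grow (`firstRowCount_swap_le`), and a
decreasing subword of length three with letters at most `k` survives (`HasDecreasing.swap`). By
Schensted's theorem such a subword exists exactly if the inner tableau has a third row, and a
tableau with at most two rows is determined by its first row. Hence a tableau between two members of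
`SYT_n^R` lies in `SYT_n^R` (`SYT.inner_eq_of_le_of_le`), and it is enough to translate single
exchanges.

If the larger exchanged letter exceeds `k`, both words have the same subword of letters at most `k`.
Replace this subword by the word with insertion tableau `R'` and the same recording tableau. This
replaces `R` with `R'` in both insertion tableaux (`InnerReplacement.insertionTableau`), and the new
words still differ by one exchange.

If both letters are at most `k`, the exchange is moved to larger letters by Knuth equivalence
(`exists_large_of_swap`). Suppose that the first row of the tableau of the preceding letters has an
entry strictly between `a` and `b`. Then `a` bumps such an entry `z`, and `b` bumps the same `y >
b`, or nothing, in either order of insertion. If there is no `y`, the two tableaux agree. Otherwise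
the exchange of `a, b` becomes that of `z, y`, and `y > k`, since `y b a` would otherwise be a
decreasing subword of small letters. If a later letter lies between `a` and `b`, the same argument
applies to the reversed words, and it can be repeated because fewer letters remain behind the pair.
If there is no separating letter of either kind, the exchange shortens the first row of the inner
tableau, which is impossible when both inner tableaux are `R`.

Translation back from `R'` to `R` is the inverse map and is monotone as well, so covers within the
fibres correspond. Convexity of the fibres gives the same for covers in all of `SYT_n`. -/

theorem rowInsert_of_lt {x a : ℕ} (l : List ℕ) (h : x < a) :
    rowInsert x (a :: l) = (x :: l, some a) := by
  simp [rowInsert, h]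

theorem rowInsert_of_le {x a : ℕ} (l : List ℕ) (h : a ≤ x) :
    rowInsert x (a :: l) = (a :: (rowInsert x l).1, (rowInsert x l).2) := by
  simp [rowInsert, not_lt.2 h]

theorem lt_of_rowInsert_eq_some {x y : ℕ} {l : List ℕ} (h : (rowInsert x l).2 = some y) :
    x < y := by
  induction l with
  | nil => simp [rowInsert] at h
  | cons a l ih =>
    rcases lt_or_ge x a with hx | hx
    · rw [rowInsert_of_lt l hx] at h
      simpa using (Option.some.inj h) ▸ hx
    · rw [rowInsert_of_le l hx] at h
      exact ih h

theorem mem_of_rowInsert_eq_some {x y : ℕ} {l : List ℕ} (h : (rowInsert x l).2 = some y) :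
    y ∈ l := by
  induction l with
  | nil => simp [rowInsert] at h
  | cons a l ih =>
    rcases lt_or_ge x a with hx | hx
    · rw [rowInsert_of_lt l hx] at h
      simp [Option.some.inj h]
    · rw [rowInsert_of_le l hx] at h
      exact List.mem_cons_of_mem _ (ih h)

theorem rowInsert_ne_nil (x : ℕ) (l : List ℕ) : (rowInsert x l).1 ≠ [] := by
  cases l with
  | nil => simp [rowInsert]
  | cons a l => rcases lt_or_ge x a with hx | hx <;> simp [rowInsert_of_lt, rowInsert_of_le, hx]

theorem mem_rowInsert_self (x : ℕ) (l : List ℕ) : x ∈ (rowInsert x l).1 := by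
  induction l with
  | nil => simp [rowInsert]
  | cons a l ih =>
    rcases lt_or_ge x a with hx | hx
    · simp [rowInsert_of_lt, hx]
    · simp [rowInsert_of_le, hx, ih]

theorem mem_or_eq_of_mem_rowInsert {x z : ℕ} {l : List ℕ} (h : z ∈ (rowInsert x l).1) :
    z = x ∨ z ∈ l := by
  induction l with
  | nil => simpa [rowInsert] using h
  | cons a l ih =>
    rcases lt_or_ge x a with hx | hx
    · rw [rowInsert_of_lt l hx] at h
      rcases List.mem_cons.1 h with h | h <;> simp [h]
    · rw [rowInsert_of_le l hx] at h
      rcases List.mem_cons.1 h with h | h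
      · simp [h]
      · rcases ih h with h | h <;> simp [h]

theorem rowInsert_append_of_some {x y : ℕ} {s : List ℕ} (l : List ℕ)
    (h : (rowInsert x s).2 = some y) :
    rowInsert x (s ++ l) = ((rowInsert x s).1 ++ l, some y) := by
  induction s with
  | nil => simp [rowInsert] at h
  | cons a s ih =>
    rcases lt_or_ge x a with hx | hx
    · rw [rowInsert_of_lt s hx] at h ⊢
      rw [List.cons_append, rowInsert_of_lt _ hx]
      simpa using h
    · rw [rowInsert_of_le s hx] at h ⊢
      rw [List.cons_append, rowInsert_of_le _ hx, ih h]
      simp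

theorem rowInsert_append_of_none {x : ℕ} {s : List ℕ} (l : List ℕ)
    (h : (rowInsert x s).2 = none) :
    rowInsert x (s ++ l) = (s ++ (rowInsert x l).1, (rowInsert x l).2) := by
  induction s with
  | nil => simp
  | cons a s ih =>
    rcases lt_or_ge x a with hx | hx
    · rw [rowInsert_of_lt s hx] at h
      simp at h
    · rw [rowInsert_of_le s hx] at h
      rw [List.cons_append, rowInsert_of_le _ hx, ih h]
      simp

theorem rowInsert_fst_of_none {x : ℕ} {s : List ℕ} (h : (rowInsert x s).2 = none) :
    (rowInsert x s).1 = s ++ [x] := by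
  have := rowInsert_append_of_none [] h
  rw [List.append_nil] at this
  rw [this]
  simp [rowInsert]

theorem length_rowInsert_of_some {x y : ℕ} {s : List ℕ} (h : (rowInsert x s).2 = some y) :
    (rowInsert x s).1.length = s.length := by
  induction s with
  | nil => simp [rowInsert] at h
  | cons a s ih =>
    rcases lt_or_ge x a with hx | hx
    · simp [rowInsert_of_lt s hx]
    · rw [rowInsert_of_le s hx] at h ⊢
      simp [ih h]

theorem rowInsert_perm (x : ℕ) (l : List ℕ) :
    ((rowInsert x l).2.toList ++ (rowInsert x l).1).Perm (x :: l) := by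
  induction l with
  | nil => simp [rowInsert]
  | cons a l ih =>
    rcases lt_or_ge x a with hx | hx
    · rw [rowInsert_of_lt l hx]
      exact List.Perm.swap x a l
    · rw [rowInsert_of_le l hx]
      exact List.perm_middle.trans ((ih.cons a).trans (List.Perm.swap x a l))

theorem pairwise_le_rowInsert (x : ℕ) {l : List ℕ} (h : l.Pairwise (· ≤ ·)) :
    (rowInsert x l).1.Pairwise (· ≤ ·) := by
  induction l with
  | nil => simp [rowInsert]
  | cons a l ih =>
    rw [List.pairwise_cons] at h
    rcases lt_or_ge x a with hx | hx
    · rw [rowInsert_of_lt l hx, List.pairwise_cons]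
      exact ⟨fun b hb => hx.le.trans (h.1 b hb), h.2⟩
    · rw [rowInsert_of_le l hx, List.pairwise_cons]
      refine ⟨fun b hb => ?_, ih h.2⟩
      rcases mem_or_eq_of_mem_rowInsert hb with rfl | hb
      · exact hx
      · exact h.1 b hb

theorem pairwise_lt_rowInsert {x : ℕ} {l : List ℕ} (h : l.Pairwise (· < ·)) (hx : x ∉ l) :
    (rowInsert x l).1.Pairwise (· < ·) := by
  induction l with
  | nil => simp [rowInsert]
  | cons a l ih =>
    rw [List.pairwise_cons] at h
    rcases lt_or_ge x a with hxa | hxa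
    · rw [rowInsert_of_lt l hxa, List.pairwise_cons]
      exact ⟨fun b hb => hxa.trans (h.1 b hb), h.2⟩
    · rw [rowInsert_of_le l hxa, List.pairwise_cons]
      refine ⟨fun b hb => ?_, ih h.2 fun h' => hx (by simp [h'])⟩
      rcases mem_or_eq_of_mem_rowInsert hb with rfl | hb
      · exact lt_of_le_of_ne hxa fun h' => hx (by simp [h'])
      · exact h.1 b hb

/-- Insertion of a word into a row: the final row and the word of replaced entries. -/
def rowInsertWord : List ℕ → List ℕ → List ℕ × List ℕ
  | r, [] => (r, [])
  | r, x :: w => ((rowInsertWord (rowInsert x r).1 w).1,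
      (rowInsert x r).2.toList ++ (rowInsertWord (rowInsert x r).1 w).2)

theorem rowInsertWord_cons_of_forall_le {a : ℕ} (l : List ℕ) {w : List ℕ} (h : ∀ x ∈ w, a ≤ x) :
    rowInsertWord (a :: l) w = (a :: (rowInsertWord l w).1, (rowInsertWord l w).2) := by
  induction w generalizing l with
  | nil => rfl
  | cons x w ih =>
    simp only [rowInsertWord]
    rw [rowInsert_of_le l (h x (by simp)), ih _ fun y hy => h y (by simp [hy])]

theorem foldl_tableauInsert_cons (w r : List ℕ) (rs : List (List ℕ)) :
    w.foldl (fun P x => tableauInsert x P) (r :: rs) =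
      (rowInsertWord r w).1 ::
        (rowInsertWord r w).2.foldl (fun P x => tableauInsert x P) rs := by
  induction w generalizing r rs with
  | nil => rfl
  | cons x w ih =>
    rw [List.foldl_cons, tableauInsert]
    cases h : (rowInsert x r).2 <;> simp [ih, rowInsertWord, h]

/-! ### Knuth equivalence -/

/-- The elementary Knuth relations on words with three letters, with repeated letters allowed. -/
inductive WeakKnuthTriple : List ℕ → List ℕ → Prop
  | xzy (x y z : ℕ) : x ≤ y → y < z → WeakKnuthTriple [x, z, y] [z, x, y]
  | yxz (x y z : ℕ) : x < y → y ≤ z → WeakKnuthTriple [y, x, z] [y, z, x]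

theorem exists_rowInsert_of_lt {y z : ℕ} (hyz : y < z) (t : List ℕ) :
    ∃ p, (rowInsert y (rowInsert z t).1).2 = some p ∧ p ≤ z := by
  induction t with
  | nil => exact ⟨z, by simp [rowInsert, hyz]⟩
  | cons a t ih =>
    rcases lt_or_ge z a with hz | hz
    · rw [rowInsert_of_lt t hz]
      exact ⟨z, by simp [rowInsert, hyz]⟩
    · rw [rowInsert_of_le t hz]
      rcases lt_or_ge y a with hy | hy
      · exact ⟨a, by simp [rowInsert, hy], hz⟩
      · rw [rowInsert_of_le _ hy]
        exact ih

theorem rowInsert_rowInsert_of_none {y z : ℕ} (hyz : y ≤ z) {t : List ℕ}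
    (h : (rowInsert y t).2 = none) (ht : t.Pairwise (· ≤ ·)) :
    (rowInsert z (rowInsert y t).1).2 = none := by
  induction t with
  | nil => simp [rowInsert, not_lt.2 hyz]
  | cons a t ih =>
    rcases lt_or_ge y a with hy | hy
    · simp [rowInsert_of_lt t hy] at h
    · rw [rowInsert_of_le t hy] at h ⊢
      rw [rowInsert_of_le _ (hy.trans hyz)]
      exact ih h ht.of_cons

theorem le_of_rowInsert_rowInsert {y z p q : ℕ} (hyz : y ≤ z) {t : List ℕ}
    (ht : t.Pairwise (· ≤ ·)) (hp : (rowInsert y t).2 = some p)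
    (hq : (rowInsert z (rowInsert y t).1).2 = some q) : p ≤ q := by
  induction t with
  | nil => simp [rowInsert] at hp
  | cons a t ih =>
    rw [List.pairwise_cons] at ht
    rcases lt_or_ge y a with hy | hy
    · rw [rowInsert_of_lt t hy] at hp hq
      rw [rowInsert_of_le _ hyz] at hq
      rw [← Option.some.inj hp]
      exact ht.1 q (mem_of_rowInsert_eq_some hq)
    · rw [rowInsert_of_le t hy] at hp hq
      rw [rowInsert_of_le _ (hy.trans hyz)] at hq
      exact ih ht.2 hp hq

/-- Induction on the row: a head that is at most all three letters stays inert, and otherwise the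
bumped words can be computed. They may be related by the other type of relation and in the opposite
direction, hence the disjunction. With weak inequalities, distinctness need not be tracked from row
to row. -/
theorem WeakKnuthTriple.rowInsertWord {w w' : List ℕ} (h : WeakKnuthTriple w w') {r : List ℕ}
    (hr : r.Pairwise (· ≤ ·)) :
    (rowInsertWord r w).1 = (rowInsertWord r w').1 ∧
      ((rowInsertWord r w).2 = (rowInsertWord r w').2 ∨
        WeakKnuthTriple (rowInsertWord r w).2 (rowInsertWord r w').2 ∨
        WeakKnuthTriple (rowInsertWord r w').2 (rowInsertWord r w).2) := by
  induction r with
  | nil =>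
    cases h with
    | xzy x y z hxy hyz =>
      have h1 : ¬ z < x := by omega
      have h2 : ¬ y < x := by omega
      have h3 : x < z := by omega
      simp [_root_.rowInsertWord, rowInsert, *]
    | yxz x y z hxy hyz =>
      have h1 : ¬ z < x := by omega
      have h2 : ¬ z < y := by omega
      simp [_root_.rowInsertWord, rowInsert, *]
  | cons a t ih =>
    rw [List.pairwise_cons] at hr
    cases h with
    | xzy x y z hxy hyz =>
      rcases lt_or_ge x a with hxa | hxa
      · rcases lt_or_ge z a with hza | hza
        · cases t with
          | nil =>
            have h1 : ¬ z < x := by omega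
            have h2 : ¬ y < x := by omega
            have h3 : x < z := by omega
            simp [_root_.rowInsertWord, rowInsert, *]
          | cons p t =>
            have hap := hr.1 p (by simp)
            have h1 : ¬ z < x := by omega
            have h2 : ¬ y < x := by omega
            have h3 : x < z := by omega
            have h4 : z < p := by omega
            have h5 : y < p := by omega
            simp only [_root_.rowInsertWord, rowInsert, hxa, hza, h1, h2, h3, h4, h5, hyz,
              if_true, if_false, Option.toList_some, List.append_nil, true_and,
              List.cons_append, List.nil_append]
            exact Or.inr (Or.inr (.yxz z a p hza hap))
        · have h1 : ¬ z < x := by omega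
          have h2 : ¬ y < x := by omega
          have h3 : ¬ z < a := by omega
          obtain ⟨p, hp, hpz⟩ := exists_rowInsert_of_lt hyz t
          have hap : a ≤ p := by
            rcases mem_or_eq_of_mem_rowInsert (mem_of_rowInsert_eq_some hp) with rfl | h
            · exact hza
            · exact hr.1 p h
          simp only [_root_.rowInsertWord, rowInsert, hxa, h1, h2, h3, hp,
              if_true, if_false, Option.toList_some, List.append_nil, true_and,
              List.cons_append, List.nil_append]
          cases hq : (rowInsert z t).2 with
          | none => simp
          | some q => exact Or.inr (Or.inl (.xzy a p q hap (hpz.trans_lt (lt_of_rowInsert_eq_some hq))))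
      · have h1 : ∀ c ∈ [x, z, y], a ≤ c := by simp; omega
        have h2 : ∀ c ∈ [z, x, y], a ≤ c := by simp; omega
        rw [rowInsertWord_cons_of_forall_le t h1, rowInsertWord_cons_of_forall_le t h2]
        simpa using ih hr.2
    | yxz x y z hxy hyz =>
      rcases lt_or_ge x a with hxa | hxa
      · have h1 : ¬ z < x := by omega
        have h2 : ¬ z < y := by omega
        rcases lt_or_ge y a with hya | hya
        · simp only [_root_.rowInsertWord, rowInsert, hya, h1, h2, hxy,
              if_true, if_false, Option.toList_some, List.append_nil, true_and,
              List.cons_append, List.nil_append]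
          cases hq : (rowInsert z t).2 with
          | none => simp
          | some q => exact Or.inr (Or.inl (.yxz y a q hya (hr.1 q (mem_of_rowInsert_eq_some hq))))
        · have h3 : ¬ y < a := by omega
          have h4 : ¬ z < a := by omega
          simp only [_root_.rowInsertWord, rowInsert, hxa, h1, h3, h4,
              if_true, if_false, Option.toList_some, List.append_nil, true_and,
              List.cons_append, List.nil_append]
          cases hp : (rowInsert y t).2 with
          | none => simp [rowInsert_rowInsert_of_none hyz hp hr.2]
          | some p =>
            cases hq : (rowInsert z (rowInsert y t).1).2 with
            | none => simp
            | some q =>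
              have hap : a < p := hya.trans_lt (lt_of_rowInsert_eq_some hp)
              exact Or.inr (Or.inl (.yxz a p q hap (le_of_rowInsert_rowInsert hyz hr.2 hp hq)))
      · have h1 : ∀ c ∈ [y, x, z], a ≤ c := by simp; omega
        have h2 : ∀ c ∈ [y, z, x], a ≤ c := by simp; omega
        rw [rowInsertWord_cons_of_forall_le t h1, rowInsertWord_cons_of_forall_le t h2]
        simpa using ih hr.2

theorem WeakKnuthTriple.foldl_tableauInsert {w w' : List ℕ} (h : WeakKnuthTriple w w')
    {L : List (List ℕ)} (hL : ∀ r ∈ L, r.Pairwise (· ≤ ·)) :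
    w.foldl (fun P x => tableauInsert x P) L = w'.foldl (fun P x => tableauInsert x P) L := by
  induction L generalizing w w' with
  | nil =>
    -- Once a letter is inserted, the empty tableau behaves like a single empty row, so that the
    -- statement on rows applies.
    have hnil : ∀ (x : ℕ) (v : List ℕ), (x :: v).foldl (fun P x => tableauInsert x P) [] =
        (x :: v).foldl (fun P x => tableauInsert x P) [[]] := fun x v => rfl
    have h' := h.rowInsertWord (r := []) List.Pairwise.nil
    have : (_root_.rowInsertWord [] w).2 = (_root_.rowInsertWord [] w').2 := by
      cases h with
      | xzy x y z hxy hyz =>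
        have h1 : ¬ z < x := by omega
        have h2 : ¬ y < x := by omega
        have h3 : x < z := by omega
        simp [_root_.rowInsertWord, rowInsert, *]
      | yxz x y z hxy hyz =>
        have h1 : ¬ z < x := by omega
        have h2 : ¬ z < y := by omega
        simp [_root_.rowInsertWord, rowInsert, *]
    cases h <;> rw [hnil, hnil, foldl_tableauInsert_cons, foldl_tableauInsert_cons, h'.1, this]
  | cons r L ih =>
    have h' := h.rowInsertWord (hL r (by simp))
    rw [foldl_tableauInsert_cons, foldl_tableauInsert_cons, h'.1]
    have hL' : ∀ s ∈ L, s.Pairwise (· ≤ ·) := fun s hs => hL s (by simp [hs])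
    rcases h'.2 with h' | h' | h'
    · rw [h']
    · rw [ih h' hL']
    · rw [ih h' hL']

theorem pairwise_le_tableauInsert (x : ℕ) {L : List (List ℕ)}
    (hL : ∀ r ∈ L, r.Pairwise (· ≤ ·)) : ∀ r ∈ tableauInsert x L, r.Pairwise (· ≤ ·) := by
  induction L generalizing x with
  | nil => simp [tableauInsert]
  | cons s L ih =>
    have hs := pairwise_le_rowInsert x (hL s (by simp))
    have hL' : ∀ r ∈ L, r.Pairwise (· ≤ ·) := fun r hr => hL r (by simp [hr])
    rw [tableauInsert]
    cases h : (rowInsert x s).2 with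
    | none => simpa [hs] using hL'
    | some y => simpa [hs] using ih y hL'

theorem insertionTableau_append (w v : List ℕ) :
    insertionTableau (w ++ v) =
      v.foldl (fun P x => tableauInsert x P) (insertionTableau w) := by
  simp [insertionTableau]

theorem insertionTableau_concat (w : List ℕ) (x : ℕ) :
    insertionTableau (w ++ [x]) = tableauInsert x (insertionTableau w) := by
  simp [insertionTableau]

theorem pairwise_le_insertionTableau (w : List ℕ) :
    ∀ r ∈ insertionTableau w, r.Pairwise (· ≤ ·) := by
  induction w using List.reverseRecOn with
  | nil => simp [insertionTableau]
  | append_singleton w x ih =>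
    rw [insertionTableau_concat]
    exact pairwise_le_tableauInsert x ih

/-- The elementary Knuth relations on words with distinct letters. -/
inductive KnuthStep : List ℕ → List ℕ → Prop
  | xzy (l r : List ℕ) (x y z : ℕ) : x < y → y < z →
      KnuthStep (l ++ [x, z, y] ++ r) (l ++ [z, x, y] ++ r)
  | yxz (l r : List ℕ) (x y z : ℕ) : x < y → y < z →
      KnuthStep (l ++ [y, x, z] ++ r) (l ++ [y, z, x] ++ r)

/-- Knuth equivalence of words. -/
def KnuthEquiv : List ℕ → List ℕ → Prop := Relation.EqvGen KnuthStep

namespace KnuthEquiv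

theorem refl (w : List ℕ) : KnuthEquiv w w := Relation.EqvGen.refl w

theorem symm {w w' : List ℕ} (h : KnuthEquiv w w') : KnuthEquiv w' w :=
  Relation.EqvGen.symm _ _ h

theorem trans {u v w : List ℕ} (h : KnuthEquiv u v) (h' : KnuthEquiv v w) : KnuthEquiv u w :=
  Relation.EqvGen.trans _ _ _ h h'

/-- A property of words respected by the elementary Knuth relations is invariant. -/
theorem induct {r : List ℕ → List ℕ → Prop} (hr : Equivalence r)
    (hs : ∀ u v, KnuthStep u v → r u v) {u v : List ℕ} (h : KnuthEquiv u v) : r u v := by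
  induction h with
  | rel _ _ h => exact hs _ _ h
  | refl _ => exact hr.refl _
  | symm _ _ _ ih => exact hr.symm ih
  | trans _ _ _ _ _ ih ih' => exact hr.trans ih ih'

theorem insertionTableau_eq {w w' : List ℕ} (h : KnuthEquiv w w') :
    insertionTableau w = insertionTableau w' := by
  refine h.induct (r := fun w w' => insertionTableau w = insertionTableau w')
    ⟨fun _ => rfl, fun h => h.symm, fun h h' => h.trans h'⟩ ?_
  intro u v h
  cases h with
  | xzy l r x y z hxy hyz =>
    rw [insertionTableau_append, insertionTableau_append, insertionTableau_append,
      insertionTableau_append,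
      (WeakKnuthTriple.xzy x y z hxy.le hyz).foldl_tableauInsert (pairwise_le_insertionTableau l)]
  | yxz l r x y z hxy hyz =>
    rw [insertionTableau_append, insertionTableau_append, insertionTableau_append,
      insertionTableau_append,
      (WeakKnuthTriple.yxz x y z hxy hyz.le).foldl_tableauInsert (pairwise_le_insertionTableau l)]

theorem perm {w w' : List ℕ} (h : KnuthEquiv w w') : w.Perm w' := by
  refine h.induct (r := List.Perm) ⟨List.Perm.refl, List.Perm.symm, List.Perm.trans⟩ ?_
  intro u v h
  cases h with
  | xzy l r x y z hxy hyz =>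
    exact ((List.Perm.swap z x [y]).append_left l).append_right r
  | yxz l r x y z hxy hyz =>
    exact (((List.Perm.swap z x []).cons y).append_left l).append_right r

theorem append (l r : List ℕ) {w w' : List ℕ} (h : KnuthEquiv w w') :
    KnuthEquiv (l ++ w ++ r) (l ++ w' ++ r) := by
  refine h.induct (r := fun w w' => KnuthEquiv (l ++ w ++ r) (l ++ w' ++ r))
    ⟨fun _ => refl _, symm, trans⟩ ?_
  intro u v h
  apply Relation.EqvGen.rel
  cases h with
  | xzy l' r' x y z hxy hyz => simpa using KnuthStep.xzy (l ++ l') (r' ++ r) x y z hxy hyz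
  | yxz l' r' x y z hxy hyz => simpa using KnuthStep.yxz (l ++ l') (r' ++ r) x y z hxy hyz

theorem append_left (l : List ℕ) {w w' : List ℕ} (h : KnuthEquiv w w') :
    KnuthEquiv (l ++ w) (l ++ w') := by
  simpa using h.append l []

theorem append_right (r : List ℕ) {w w' : List ℕ} (h : KnuthEquiv w w') :
    KnuthEquiv (w ++ r) (w' ++ r) := by
  simpa using h.append [] r

theorem cons (x : ℕ) {w w' : List ℕ} (h : KnuthEquiv w w') : KnuthEquiv (x :: w) (x :: w') :=
  h.append_left [x]

/-- Reversal interchanges the two types of elementary relations. -/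
theorem reverse {w w' : List ℕ} (h : KnuthEquiv w w') : KnuthEquiv w.reverse w'.reverse := by
  refine h.induct (r := fun w w' => KnuthEquiv w.reverse w'.reverse)
    ⟨fun _ => refl _, symm, trans⟩ ?_
  intro u v h
  cases h with
  | xzy l r x y z hxy hyz =>
    exact symm (Relation.EqvGen.rel _ _
      (by simpa using KnuthStep.yxz r.reverse l.reverse x y z hxy hyz))
  | yxz l r x y z hxy hyz =>
    exact symm (Relation.EqvGen.rel _ _
      (by simpa using KnuthStep.xzy r.reverse l.reverse x y z hxy hyz))

theorem xzy (r : List ℕ) {x y z : ℕ} (hxy : x < y) (hyz : y < z) :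
    KnuthEquiv (x :: z :: y :: r) (z :: x :: y :: r) :=
  Relation.EqvGen.rel _ _ (by simpa using KnuthStep.xzy [] r x y z hxy hyz)

theorem yxz (r : List ℕ) {x y z : ℕ} (hxy : x < y) (hyz : y < z) :
    KnuthEquiv (y :: x :: z :: r) (y :: z :: x :: r) :=
  Relation.EqvGen.rel _ _ (by simpa using KnuthStep.yxz [] r x y z hxy hyz)

/-- The letter `x` moves right through the row; at each move the letter on its left is the middle
value of the relation. -/
theorem cons_cons_of_lt {x h : ℕ} {t : List ℕ} (hx : x < h) (ht : (h :: t).Pairwise (· < ·)) :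
    KnuthEquiv (h :: x :: t) (h :: (t ++ [x])) := by
  induction t generalizing h with
  | nil => exact refl _
  | cons p t ih =>
    have hp : h < p := (List.pairwise_cons.1 ht).1 p (by simp)
    exact (yxz t hx hp).trans ((ih (hx.trans hp) ht.of_cons).cons h)

/-- A row followed by a letter is Knuth equivalent to the replaced entry followed by the new row. -/
theorem row_append {x : ℕ} {r : List ℕ} (hr : r.Pairwise (· < ·)) (hx : x ∉ r) :
    KnuthEquiv (r ++ [x]) ((rowInsert x r).2.toList ++ (rowInsert x r).1) := by
  induction r with
  | nil => exact refl _
  | cons h t ih =>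
    rcases lt_or_ge x h with hxh | hxh
    · rw [rowInsert_of_lt t hxh]
      exact (cons_cons_of_lt hxh hr).symm
    · have hxh' : h < x := lt_of_le_of_ne hxh fun h' => hx (by simp [h'])
      have ih := (ih hr.of_cons fun h' => hx (by simp [h'])).cons h
      rw [rowInsert_of_le t hxh]
      refine KnuthEquiv.trans ih ?_
      cases hy : (rowInsert x t).2 with
      | none => exact refl _
      | some y =>
        have hxy := lt_of_rowInsert_eq_some hy
        cases t with
        | nil => simp [rowInsert] at hy
        | cons p t =>
          -- The bumped letter `y` moves left past `h`. The middle value is the head of the new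
          -- tail, which is `x` or `p`.
          rcases lt_or_ge x p with hxp | hxp
          · rw [rowInsert_of_lt t hxp]
            exact xzy t hxh' hxy
          · rw [rowInsert_of_le t hxp]
            exact xzy _ ((List.pairwise_cons.1 hr).1 p (by simp)) (hxp.trans_lt hxy)

end KnuthEquiv

/-! ### Reading words -/

theorem flatten_tableauInsert_perm (x : ℕ) (L : List (List ℕ)) :
    (tableauInsert x L).flatten.Perm (x :: L.flatten) := by
  induction L generalizing x with
  | nil => simp [tableauInsert]
  | cons r L ih =>
    have h := rowInsert_perm x r
    rw [tableauInsert]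
    cases hy : (rowInsert x r).2 with
    | none =>
      rw [hy] at h
      simpa using h.append_right L.flatten
    | some y =>
      rw [hy] at h
      have h1 : ((rowInsert x r).1 ++ (tableauInsert y L).flatten).Perm
          ((rowInsert x r).1 ++ y :: L.flatten) := (ih y).append_left _
      have h2 : ((rowInsert x r).1 ++ y :: L.flatten).Perm
          (y :: ((rowInsert x r).1 ++ L.flatten)) := List.perm_middle
      simpa using h1.trans (h2.trans (h.append_right L.flatten))

theorem flatten_insertionTableau_perm (w : List ℕ) : (insertionTableau w).flatten.Perm w := by
  induction w using List.reverseRecOn with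
  | nil => simp [insertionTableau]
  | append_singleton w x ih =>
    rw [insertionTableau_concat]
    exact (flatten_tableauInsert_perm x _).trans
      ((ih.cons x).trans (List.perm_append_singleton x w).symm)

theorem headD_tableauInsert (x : ℕ) (L : List (List ℕ)) :
    (tableauInsert x L).headD [] = (rowInsert x (L.headD [])).1 := by
  cases L with
  | nil => simp [tableauInsert, rowInsert]
  | cons r L => rw [tableauInsert]; cases (rowInsert x r).2 <;> simp

/-- The rows of a tableau read from bottom to top. -/
def readingWord (L : List (List ℕ)) : List ℕ := L.reverse.flatten

theorem readingWord_cons (r : List ℕ) (L : List (List ℕ)) :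
    readingWord (r :: L) = readingWord L ++ r := by
  simp [readingWord]

theorem readingWord_perm (L : List (List ℕ)) : (readingWord L).Perm L.flatten :=
  L.reverse_perm.flatten

theorem pairwise_lt_tableauInsert {x : ℕ} {L : List (List ℕ)}
    (hL : ∀ r ∈ L, r.Pairwise (· < ·)) (hx : (x :: L.flatten).Nodup) :
    ∀ r ∈ tableauInsert x L, r.Pairwise (· < ·) := by
  induction L generalizing x with
  | nil => simp [tableauInsert]
  | cons s L ih =>
    have hxs : x ∉ s := fun h => (List.nodup_cons.1 hx).1 (by simp [h])
    have hs := pairwise_lt_rowInsert (hL s (by simp)) hxs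
    have hL' : ∀ r ∈ L, r.Pairwise (· < ·) := fun r hr => hL r (by simp [hr])
    rw [tableauInsert]
    cases h : (rowInsert x s).2 with
    | none => simpa [hs] using hL'
    | some y =>
      have hys := mem_of_rowInsert_eq_some h
      have hnd : (s ++ L.flatten).Nodup := by simpa using (List.nodup_cons.1 hx).2
      have hy : (y :: L.flatten).Nodup :=
        List.nodup_cons.2 ⟨fun h' => List.disjoint_of_nodup_append hnd hys h', hnd.of_append_right⟩
      simpa [hs] using ih hL' hy

theorem nodup_cons_flatten_insertionTableau {w : List ℕ} {x : ℕ} (h : (w ++ [x]).Nodup) :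
    (x :: (insertionTableau w).flatten).Nodup :=
  ((flatten_insertionTableau_perm w).cons x).nodup_iff.2
    ((List.perm_append_singleton x w).nodup_iff.1 h)

theorem pairwise_lt_insertionTableau {w : List ℕ} (h : w.Nodup) :
    ∀ r ∈ insertionTableau w, r.Pairwise (· < ·) := by
  induction w using List.reverseRecOn with
  | nil => simp [insertionTableau]
  | append_singleton w x ih =>
    rw [insertionTableau_concat]
    exact pairwise_lt_tableauInsert (ih h.of_append_left) (nodup_cons_flatten_insertionTableau h)

namespace KnuthEquiv

/-- By `row_append` the bumped letter comes out in front of the changed row, and there it stands at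
the end of the reading word of the rows below. -/
theorem readingWord_tableauInsert {x : ℕ} {L : List (List ℕ)}
    (hL : ∀ r ∈ L, r.Pairwise (· < ·)) (hx : (x :: L.flatten).Nodup) :
    KnuthEquiv (readingWord L ++ [x]) (readingWord (tableauInsert x L)) := by
  induction L generalizing x with
  | nil => exact refl _
  | cons s L ih =>
    have hxs : x ∉ s := fun h => (List.nodup_cons.1 hx).1 (by simp [h])
    have hs := row_append (hL s (by simp)) hxs
    have hL' : ∀ r ∈ L, r.Pairwise (· < ·) := fun r hr => hL r (by simp [hr])
    rw [tableauInsert, readingWord_cons]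
    cases h : (rowInsert x s).2 with
    | none =>
      rw [h] at hs
      simpa [readingWord_cons] using hs.append_left (readingWord L)
    | some y =>
      rw [h] at hs
      have hys := mem_of_rowInsert_eq_some h
      have hnd : (s ++ L.flatten).Nodup := by simpa using (List.nodup_cons.1 hx).2
      have hy : (y :: L.flatten).Nodup :=
        List.nodup_cons.2 ⟨fun h' => List.disjoint_of_nodup_append hnd hys h', hnd.of_append_right⟩
      have h1 := hs.append_left (readingWord L)
      have h2 := (ih hL' hy).append_right (rowInsert x s).1
      simp only [readingWord_cons, List.append_assoc, Option.toList_some, List.cons_append,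
        List.nil_append] at h1 h2 ⊢
      exact h1.trans h2

theorem readingWord_insertionTableau {w : List ℕ} (h : w.Nodup) :
    KnuthEquiv w (readingWord (insertionTableau w)) := by
  induction w using List.reverseRecOn with
  | nil => exact refl _
  | append_singleton w x ih =>
    rw [insertionTableau_concat]
    exact ((ih h.of_append_left).append_right [x]).trans (readingWord_tableauInsert
      (pairwise_lt_insertionTableau h.of_append_left) (nodup_cons_flatten_insertionTableau h))

/-- A word is Knuth equivalent to one that ends with the first row of its insertion tableau. -/
theorem exists_append_headD {w : List ℕ} (h : w.Nodup) :
    ∃ v, KnuthEquiv w (v ++ (insertionTableau w).headD []) := by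
  have h' := readingWord_insertionTableau h
  cases hL : insertionTableau w with
  | nil => exact ⟨[], by simpa [hL, readingWord] using h'⟩
  | cons r L => exact ⟨readingWord L, by simpa [hL, readingWord_cons] using h'⟩

end KnuthEquiv

/-- An entry with value between `a` and `b` forces `a` to act strictly to the left of the place
where `b` acts, so the two insertions do not interfere. -/
theorem rowInsert_comm {a b : ℕ} {r : List ℕ} (hab : a < b) (hr : r.Pairwise (· < ·))
    (hz : ∃ z ∈ r, a < z ∧ z < b) :
    ∃ z ∈ r, a < z ∧ z < b ∧ (rowInsert a r).2 = some z ∧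
      (rowInsert b (rowInsert a r).1).2 = (rowInsert b r).2 ∧
      (rowInsert a (rowInsert b r).1).2 = some z ∧
      (rowInsert a (rowInsert b r).1).1 = (rowInsert b (rowInsert a r).1).1 := by
  induction r with
  | nil => simp at hz
  | cons h t ih =>
    rw [List.pairwise_cons] at hr
    obtain ⟨z, hz, haz, hzb⟩ := hz
    have hhz : h ≤ z := by
      rcases List.mem_cons.1 hz with rfl | hz
      · exact le_rfl
      · exact (hr.1 z hz).le
    have hhb : h ≤ b := hhz.trans hzb.le
    rcases lt_or_ge a h with hah | hah
    · refine ⟨h, by simp, hah, hhz.trans_lt hzb, ?_⟩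
      simp [rowInsert_of_lt t hah, rowInsert_of_le t hhb, rowInsert_of_le t hab.le,
        rowInsert_of_lt _ hah]
    · have hzt : z ∈ t := by
        rcases List.mem_cons.1 hz with rfl | hz
        · omega
        · exact hz
      obtain ⟨z, hz, haz, hzb, h1, h2, h3, h4⟩ := ih hr.2 ⟨z, hzt, haz, hzb⟩
      refine ⟨z, by simp [hz], haz, hzb, ?_⟩
      simp [rowInsert_of_le _ hah, rowInsert_of_le _ hhb, h1, h2, h3, h4]

/-- If a row has an entry strictly between two letters `a < b`, then inserting them in either order
gives the same row, and replaces the same entries in either order. -/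
theorem KnuthEquiv.row_append_pair {a b : ℕ} {r : List ℕ} (hab : a < b) (hr : r.Pairwise (· < ·))
    (ha : a ∉ r) (hb : b ∉ r) (hz : ∃ z ∈ r, a < z ∧ z < b) :
    ∃ z ∈ r, a < z ∧ z < b ∧ ∃ r' : List ℕ,
      KnuthEquiv (r ++ [a, b]) (z :: ((rowInsert b r).2.toList ++ r')) ∧
      KnuthEquiv (r ++ [b, a]) ((rowInsert b r).2.toList ++ z :: r') := by
  obtain ⟨z, hz, haz, hzb, h1, h2, h3, h4⟩ := rowInsert_comm hab hr hz
  refine ⟨z, hz, haz, hzb, (rowInsert b (rowInsert a r).1).1, ?_, ?_⟩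
  · have k1 := (row_append hr ha).append_right [b]
    have hb' : b ∉ (rowInsert a r).1 := fun h => by
      rcases mem_or_eq_of_mem_rowInsert h with h | h
      · omega
      · exact hb h
    have k2 := (row_append (pairwise_lt_rowInsert hr ha) hb').append_left [z]
    rw [h1] at k1
    rw [h2] at k2
    simp only [List.append_assoc, Option.toList_some, List.cons_append, List.nil_append] at k1 k2
    exact k1.trans k2
  · have k1 := (row_append hr hb).append_right [a]
    have ha' : a ∉ (rowInsert b r).1 := fun h => by
      rcases mem_or_eq_of_mem_rowInsert h with h | h
      · omega
      · exact ha h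
    have k2 := (row_append (pairwise_lt_rowInsert hr hb) ha').append_left (rowInsert b r).2.toList
    rw [h3, h4] at k2
    simp only [List.append_assoc, Option.toList_some, List.cons_append, List.nil_append] at k1 k2
    exact k1.trans k2

/-! ### Decreasing subwords -/

/-- The word `w` has a decreasing subword of length `m` with letters at most `k`. -/
def HasDecreasing (m k : ℕ) (w : List ℕ) : Prop :=
  ∃ s : List ℕ, s.Sublist w ∧ s.Pairwise (· > ·) ∧ s.length = m ∧ ∀ x ∈ s, x ≤ k

/-- The bounds of `s'` by letters of `s` on both sides let `s'` take the place of `s` between the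
letters chosen in `l` and in `r`, and keep it at most `k`. -/
theorem HasDecreasing.replace {m k : ℕ} {l r u v : List ℕ} (h : HasDecreasing m k (l ++ u ++ r))
    (huv : ∀ s : List ℕ, s.Sublist u → s.Pairwise (· > ·) → ∃ s' : List ℕ, s'.Sublist v ∧ s'.Pairwise (· > ·) ∧
      s'.length = s.length ∧ (∀ x ∈ s', ∃ y ∈ s, x ≤ y) ∧ ∀ x ∈ s', ∃ y ∈ s, y ≤ x) :
    HasDecreasing m k (l ++ v ++ r) := by
  obtain ⟨s, hs, hdec, hlen, hk⟩ := h
  obtain ⟨s₁, s₃, rfl, h₁, h₃⟩ := List.sublist_append_iff.1 hs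
  obtain ⟨s₁, s₂, rfl, h₁, h₂⟩ := List.sublist_append_iff.1 h₁
  simp only [List.pairwise_append, List.mem_append] at hdec
  obtain ⟨⟨d1, d2, d3⟩, d4, d5⟩ := hdec
  obtain ⟨s', hs', hdec', hlen', hup, hlow⟩ := huv s₂ h₂ d2
  refine ⟨s₁ ++ s' ++ s₃, (h₁.append hs').append h₃, ?_, ?_, ?_⟩
  · simp only [List.pairwise_append, List.mem_append]
    refine ⟨⟨d1, hdec', fun x hx y hy => ?_⟩, d4, ?_⟩
    · obtain ⟨z, hz, hyz⟩ := hup y hy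
      exact hyz.trans_lt (d3 x hx z hz)
    · rintro x (hx | hx) y hy
      · exact d5 x (Or.inl hx) y hy
      · obtain ⟨z, hz, hyz⟩ := hlow x hx
        exact (d5 z (Or.inr hz) y hy).trans_le hyz
  · simpa [hlen'] using hlen
  · intro x hx
    simp only [List.mem_append] at hx hk
    rcases hx with (hx | hx) | hx
    · exact hk x (by simp [hx])
    · obtain ⟨z, hz, hyz⟩ := hup x hx
      exact hyz.trans (hk z (by simp [hz]))
    · exact hk x (by simp [hx])

/-- The pair `z, x` is the only decreasing subword of one triple that is missing in the other. There
it is replaced by `z, y` or `y, x`, whose letters lie between `x` and `z`. -/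
theorem KnuthStep.hasDecreasing_iff {m k : ℕ} {u v : List ℕ} (h : KnuthStep u v) :
    HasDecreasing m k u ↔ HasDecreasing m k v := by
  have keep : ∀ {s v : List ℕ}, s.Sublist v → s.Pairwise (· > ·) → ∃ s' : List ℕ,
      s'.Sublist v ∧ s'.Pairwise (· > ·) ∧ s'.length = s.length ∧
      (∀ x ∈ s', ∃ y ∈ s, x ≤ y) ∧ ∀ x ∈ s', ∃ y ∈ s, y ≤ x := fun {s v} h h' =>
    ⟨s, h, h', rfl, fun x hx => ⟨x, hx, le_rfl⟩, fun x hx => ⟨x, hx, le_rfl⟩⟩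
  cases h with
  | xzy l r x y z hxy hyz =>
    constructor <;> intro h <;> refine h.replace fun s hs hdec => ?_ <;>
      rw [← List.mem_sublists'] at hs <;> simp [List.sublists'] at hs <;>
      rcases hs with rfl | rfl | rfl | rfl | rfl | rfl | rfl | rfl <;>
      first
      | (exfalso; simp at hdec; omega)
      | (refine keep ?_ hdec; simp)
      | (refine keep ?_ hdec; simp [List.cons_sublist_cons']; done)
      | exact ⟨[z, y], by simp, by simpa using hyz, rfl, by simp; omega, by simp; omega⟩
  | yxz l r x y z hxy hyz =>
    constructor <;> intro h <;> refine h.replace fun s hs hdec => ?_ <;>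
      rw [← List.mem_sublists'] at hs <;> simp [List.sublists'] at hs <;>
      rcases hs with rfl | rfl | rfl | rfl | rfl | rfl | rfl | rfl <;>
      first
      | (exfalso; simp at hdec; omega)
      | (refine keep ?_ hdec; simp)
      | (refine keep ?_ hdec; simp [List.cons_sublist_cons']; done)
      | exact ⟨[y, x], by simp, by simpa using hxy, rfl, by simp; omega, by simp; omega⟩

theorem KnuthEquiv.hasDecreasing_iff {m k : ℕ} {u v : List ℕ} (h : KnuthEquiv u v) :
    HasDecreasing m k u ↔ HasDecreasing m k v :=
  h.induct (r := fun u v => HasDecreasing m k u ↔ HasDecreasing m k v)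
    ⟨fun _ => Iff.rfl, Iff.symm, Iff.trans⟩ fun _ _ => KnuthStep.hasDecreasing_iff

/-- A decreasing subword uses at most one letter of the increasing pair, and so does not notice the
exchange. -/
theorem HasDecreasing.swap {m k a b : ℕ} {w v : List ℕ} (hab : a < b)
    (h : HasDecreasing m k (w ++ a :: b :: v)) : HasDecreasing m k (w ++ b :: a :: v) := by
  have h : HasDecreasing m k (w ++ [a, b] ++ v) := by simpa using h
  have := h.replace (v := [b, a]) fun s hs hdec => by
    have hs' : s.Sublist [b, a] := by
      rw [← List.mem_sublists'] at hs
      simp [List.sublists'] at hs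
      rcases hs with rfl | rfl | rfl | rfl
      · simp
      · simp
      · simp
      · simp at hdec
        omega
    exact ⟨s, hs', hdec, rfl, fun x hx => ⟨x, hx, le_rfl⟩, fun x hx => ⟨x, hx, le_rfl⟩⟩
  simpa using this

theorem hasDecreasing_three_of_mem_left {k a b x : ℕ} {w v : List ℕ} (hx : x ∈ w) (hab : a < b)
    (hbx : b < x) (hxk : x ≤ k) : HasDecreasing 3 k (w ++ b :: a :: v) := by
  refine ⟨[x] ++ [b, a], (List.singleton_sublist.2 hx).append (by simp), ?_, rfl, ?_⟩ <;>
    simp <;> omega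

theorem hasDecreasing_three_of_mem_right {k a b x : ℕ} {w v : List ℕ} (hx : x ∈ v) (hab : a < b)
    (hxa : x < a) (hbk : b ≤ k) : HasDecreasing 3 k (w ++ b :: a :: v) := by
  refine ⟨[b, a, x], ?_, ?_, rfl, ?_⟩
  · exact List.Sublist.trans (by simpa using hx) (List.sublist_append_right w _)
  all_goals simp; omega

/-! ### Tableaux as lists of rows -/

/-- The number of letters of `r` smaller than `e`. -/
def countLT (r : List ℕ) (e : ℕ) : ℕ := r.countP (· < e)

theorem countLT_cons (a : ℕ) (r : List ℕ) (e : ℕ) :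
    countLT (a :: r) e = countLT r e + if a < e then 1 else 0 := by
  simp [countLT, List.countP_cons]

theorem countLT_nil (e : ℕ) : countLT [] e = 0 := rfl

theorem countLT_append (r s : List ℕ) (e : ℕ) :
    countLT (r ++ s) e = countLT r e + countLT s e := by
  simp [countLT]

theorem countLT_mono (r : List ℕ) {e e' : ℕ} (h : e ≤ e') : countLT r e ≤ countLT r e' := by
  apply List.countP_mono_left
  simp only [decide_eq_true_eq]
  omega

theorem countLT_le_length (r : List ℕ) (e : ℕ) : countLT r e ≤ r.length := List.countP_le_length

theorem countLT_eq_length {r : List ℕ} {e : ℕ} (h : ∀ x ∈ r, x < e) : countLT r e = r.length := by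
  simpa [countLT, List.countP_eq_length] using h

theorem countLT_eq_zero {r : List ℕ} {e : ℕ} (h : ∀ x ∈ r, e ≤ x) : countLT r e = 0 := by
  simpa [countLT, List.countP_eq_zero] using h

theorem countLT_pos {r : List ℕ} {e : ℕ} : 0 < countLT r e ↔ ∃ x ∈ r, x < e := by
  simp [countLT, List.countP_pos_iff]

theorem countLT_succ_le (r : List ℕ) {x e : ℕ} (hx : x ∈ r) (hxe : x < e) :
    countLT r x + 1 ≤ countLT r e := by
  induction r with
  | nil => simp at hx
  | cons a r ih =>
    rw [countLT_cons, countLT_cons]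
    rcases List.mem_cons.1 hx with rfl | hx
    · have := countLT_mono r hxe.le
      simp [hxe]
      omega
    · have := ih hx
      split_ifs <;> omega

/-- The letter `x` is placed right after the entries at most `x`. For `e > x` the count therefore
grows by one exactly if no entry strictly between `x` and `e` is there to be replaced, which is what
the maximum expresses. -/
theorem countLT_rowInsert (x : ℕ) {r : List ℕ} (hr : r.Pairwise (· ≤ ·)) (e : ℕ) :
    countLT (rowInsert x r).1 e =
      if e ≤ x then countLT r e else max (countLT r e) (countLT r (x + 1) + 1) := by
  induction r with
  | nil => simp [rowInsert, countLT_cons, countLT_nil]; split_ifs <;> omega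
  | cons a r ih =>
    rw [List.pairwise_cons] at hr
    rcases lt_or_ge x a with hx | hx
    · have h0 : countLT r (x + 1) = 0 :=
        countLT_eq_zero fun b hb => hx.trans_le (hr.1 b hb)
      rw [rowInsert_of_lt r hx]
      simp only [countLT_cons, h0]
      rcases le_or_gt e a with h | h
      · have h1 : countLT r e = 0 := countLT_eq_zero fun b hb => h.trans (hr.1 b hb)
        split_ifs <;> omega
      · split_ifs <;> omega
    · rw [rowInsert_of_le r hx]
      simp only [countLT_cons, ih hr.2]
      split_ifs <;> omega

theorem countLT_of_rowInsert_eq_some {x y : ℕ} {r : List ℕ} (hr : r.Pairwise (· ≤ ·))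
    (h : (rowInsert x r).2 = some y) : countLT r y = countLT r (x + 1) := by
  induction r with
  | nil => simp [rowInsert] at h
  | cons a r ih =>
    rw [List.pairwise_cons] at hr
    rcases lt_or_ge x a with hx | hx
    · rw [rowInsert_of_lt r hx] at h
      have := Option.some.inj h
      subst this
      have h1 : countLT r a = 0 := countLT_eq_zero hr.1
      have h2 : countLT r (x + 1) = 0 := countLT_eq_zero fun b hb => hx.trans_le (hr.1 b hb)
      rw [countLT_cons, countLT_cons, h1, h2]
      split_ifs <;> omega
    · rw [rowInsert_of_le r hx] at h
      have := lt_of_rowInsert_eq_some h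
      rw [countLT_cons, countLT_cons, ih hr.2 h]
      split_ifs <;> omega

/-- The row `r` can be placed above the row `r'` in a tableau. -/
def RowDominates (r r' : List ℕ) : Prop := ∀ e, countLT r' (e + 1) ≤ countLT r e

theorem RowDominates.length_le {r r' : List ℕ} (h : RowDominates r r') :
    r'.length ≤ r.length := by
  -- The sum of `r'` bounds each of its letters, so the count for `r'` is its full length.
  have h1 := h (r'.sum + 1)
  rw [countLT_eq_length] at h1
  · exact h1.trans (countLT_le_length _ _)
  · intro x hx
    have := List.single_le_sum (l := r') (by simp) x hx
    omega

theorem RowDominates.nil (r : List ℕ) : RowDominates r [] := fun _ => by simp [countLT_nil]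

theorem RowDominates.exists_lt {r r' : List ℕ} (h : RowDominates r r') {x : ℕ} (hx : x ∈ r') :
    ∃ y ∈ r, y < x :=
  countLT_pos.1 ((countLT_pos.2 ⟨x, hx, Nat.lt_succ_self x⟩).trans_le (h x))

/-- `L` is the list of rows of a tableau with distinct entries in each row. -/
def IsTableau : List (List ℕ) → Prop
  | [] => True
  | r :: L => r ≠ [] ∧ r.Pairwise (· < ·) ∧ RowDominates r (L.headD []) ∧ IsTableau L

theorem IsTableau.pairwise_lt {L : List (List ℕ)} (h : IsTableau L) :
    ∀ r ∈ L, r.Pairwise (· < ·) := by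
  induction L with
  | nil => simp
  | cons r L ih => simpa [h.2.1] using ih h.2.2.2

/-- A bumped entry never moves to the right when it enters the next row: this is dominance at `y`.
The rest is arithmetic with the counts. -/
theorem RowDominates.rowInsert {r r' : List ℕ} (h : RowDominates r r') {x y : ℕ}
    (hr : r.Pairwise (· ≤ ·)) (hr' : r'.Pairwise (· ≤ ·)) (hy : (rowInsert x r).2 = some y) :
    RowDominates (rowInsert x r).1 (_root_.rowInsert y r').1 := by
  intro e
  rw [countLT_rowInsert x hr, countLT_rowInsert y hr']
  have hxy := lt_of_rowInsert_eq_some hy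
  have h1 := h e
  have h2 := h y
  rw [countLT_of_rowInsert_eq_some hr hy] at h2
  split_ifs <;> omega

theorem RowDominates.rowInsert_left {r r' : List ℕ} (h : RowDominates r r') (x : ℕ)
    (hr : r.Pairwise (· ≤ ·)) : RowDominates (_root_.rowInsert x r).1 r' := by
  intro e
  rw [countLT_rowInsert x hr]
  have h1 := h e
  split_ifs <;> omega

theorem IsTableau.tableauInsert {x : ℕ} {L : List (List ℕ)} (hL : IsTableau L)
    (hx : (x :: L.flatten).Nodup) : IsTableau (tableauInsert x L) := by
  induction L generalizing x with
  | nil => exact ⟨by simp, by simp, RowDominates.nil _, trivial⟩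
  | cons s L ih =>
    obtain ⟨h1, h2, h3, h4⟩ := hL
    have hxs : x ∉ s := fun h => (List.nodup_cons.1 hx).1 (by simp [h])
    have hs := pairwise_lt_rowInsert h2 hxs
    have hs' := h2.imp (fun {a b : ℕ} (h : a < b) => h.le)
    rw [_root_.tableauInsert]
    cases h : (rowInsert x s).2 with
    | none => exact ⟨rowInsert_ne_nil x s, hs, h3.rowInsert_left x hs', h4⟩
    | some y =>
      have hys := mem_of_rowInsert_eq_some h
      have hnd : (s ++ L.flatten).Nodup := by simpa using (List.nodup_cons.1 hx).2
      have hy : (y :: L.flatten).Nodup :=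
        List.nodup_cons.2 ⟨fun h' => List.disjoint_of_nodup_append hnd hys h', hnd.of_append_right⟩
      refine ⟨rowInsert_ne_nil x s, hs, ?_, ih h4 hy⟩
      rw [headD_tableauInsert]
      refine h3.rowInsert hs' ?_ h
      cases L with
      | nil => simp
      | cons r L => exact h4.2.1.imp (fun {a b : ℕ} (h : a < b) => h.le)

theorem isTableau_insertionTableau {w : List ℕ} (h : w.Nodup) :
    IsTableau (insertionTableau w) := by
  induction w using List.reverseRecOn with
  | nil => exact trivial
  | append_singleton w x ih =>
    rw [insertionTableau_concat]
    exact (ih h.of_append_left).tableauInsert (nodup_cons_flatten_insertionTableau h)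

/-! ### The first row -/

/-- The number of entries smaller than `e` in the first row of the insertion tableau of `w`. -/
def firstRowCount (w : List ℕ) (e : ℕ) : ℕ := countLT ((insertionTableau w).headD []) e

theorem firstRowCount_concat (w : List ℕ) (x e : ℕ) :
    firstRowCount (w ++ [x]) e = if e ≤ x then firstRowCount w e
      else max (firstRowCount w e) (firstRowCount w (x + 1) + 1) := by
  rw [firstRowCount, insertionTableau_concat, headD_tableauInsert, countLT_rowInsert]
  · rfl
  · have := pairwise_le_insertionTableau w
    cases h : insertionTableau w with
    | nil => simp
    | cons r L => exact this r (by simp [h])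

theorem firstRowCount_append_pair (w : List ℕ) (a b e : ℕ) :
    firstRowCount (w ++ [a, b]) e = firstRowCount ((w ++ [a]) ++ [b]) e := by
  simp

/-- The recursion `firstRowCount_concat` is monotone in the earlier counts, so a comparison survives
a common suffix. -/
theorem firstRowCount_append_le {w w' : List ℕ}
    (h : ∀ e, firstRowCount w e ≤ firstRowCount w' e) (v : List ℕ) (e : ℕ) :
    firstRowCount (w ++ v) e ≤ firstRowCount (w' ++ v) e := by
  induction v using List.reverseRecOn generalizing e with
  | nil => simpa using h e
  | append_singleton v x ih =>
    rw [← List.append_assoc, ← List.append_assoc, firstRowCount_concat, firstRowCount_concat]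
    have h1 := ih e
    have h2 := ih (x + 1)
    split_ifs <;> omega

theorem firstRowCount_swap_le (w v : List ℕ) {a b : ℕ} (hab : a < b) (e : ℕ) :
    firstRowCount (w ++ b :: a :: v) e ≤ firstRowCount (w ++ a :: b :: v) e := by
  have := firstRowCount_append_le (w := w ++ [b, a]) (w' := w ++ [a, b]) (fun e => ?_) v e
  · simpa using this
  · simp only [firstRowCount_append_pair, firstRowCount_concat]
    have h1 : firstRowCount w (a + 1) ≤ firstRowCount w (b + 1) :=
      countLT_mono _ (by omega)
    split_ifs <;> omega

theorem firstRowCount_append_of_le (w : List ℕ) {v : List ℕ} {e : ℕ} (h : ∀ x ∈ v, e ≤ x) :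
    firstRowCount (w ++ v) e = firstRowCount w e := by
  induction v using List.reverseRecOn with
  | nil => simp
  | append_singleton v x ih =>
    rw [← List.append_assoc, firstRowCount_concat, if_pos (h x (by simp)),
      ih fun y hy => h y (by simp [hy])]

/-! ### Decreasing subwords and rows -/

/-- Rows increase, so a decreasing subword takes at most one letter from the first row, which is
read last. -/
theorem HasDecreasing.tail {m k : ℕ} {L : List (List ℕ)} (hL : ∀ r ∈ L, r.Pairwise (· < ·))
    (h : HasDecreasing (m + 1) k (readingWord L)) : HasDecreasing m k (readingWord L.tail) := by
  obtain ⟨s, hs, hdec, hlen, hk⟩ := h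
  cases L with
  | nil => simp [readingWord] at hs; simp [hs] at hlen
  | cons r L =>
    rw [readingWord_cons] at hs
    obtain ⟨s₁, s₂, rfl, h₁, h₂⟩ := List.sublist_append_iff.1 hs
    rw [List.pairwise_append] at hdec
    have hs₂ : s₂.length ≤ 1 := by
      have := (hL r (by simp)).sublist h₂
      match s₂, this, hdec.2.1 with
      | [], _, _ => simp
      | [_], _, _ => simp
      | a :: b :: _, h1, h2 =>
        have h1 := (List.pairwise_cons.1 h1).1 b (by simp)
        have h2 := (List.pairwise_cons.1 h2).1 b (by simp)
        omega
    rw [List.length_append] at hlen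
    -- If the first row contributes no letter, `s₁` is one letter too long.
    refine ⟨s₁.take m, (List.take_sublist _ _).trans h₁, hdec.1.sublist (List.take_sublist _ _),
      ?_, fun x hx => hk x (by simp [List.mem_of_mem_take hx])⟩
    rw [List.length_take]
    omega

theorem IsTableau.exists_lt {r : List ℕ} {L : List (List ℕ)} (h : IsTableau (r :: L)) {x : ℕ}
    (hx : x ∈ L.flatten) : ∃ y ∈ r, y < x := by
  induction L generalizing r with
  | nil => simp at hx
  | cons s L ih =>
    rw [List.flatten_cons, List.mem_append] at hx
    have h3 : RowDominates r s := h.2.2.1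
    rcases hx with hx | hx
    · exact h3.exists_lt hx
    · obtain ⟨y, hy, hyx⟩ := ih h.2.2.2 hx
      obtain ⟨z, hz, hzy⟩ := h3.exists_lt hy
      exact ⟨z, hz, hzy.trans hyx⟩

/-- Climb from `x`: every row above has a smaller entry and is read later. -/
theorem IsTableau.hasDecreasing {m k x : ℕ} {L : List (List ℕ)} (h : IsTableau L)
    (hx : x ∈ (L.drop m).flatten) (hxk : x ≤ k) : HasDecreasing (m + 1) k (readingWord L) := by
  induction m generalizing L with
  | zero =>
    refine ⟨[x], List.singleton_sublist.2 ?_, by simp, rfl, by simpa using hxk⟩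
    exact (readingWord_perm L).mem_iff.2 hx
  | succ m ih =>
    cases L with
    | nil => simp at hx
    | cons r L =>
      obtain ⟨s, hs, hdec, hlen, hk⟩ := ih h.2.2.2 hx
      obtain ⟨s, e, rfl⟩ := List.eq_nil_or_concat s |>.resolve_left (by rintro rfl; simp at hlen)
      rw [List.concat_eq_append] at *
      obtain ⟨y, hy, hye⟩ := h.exists_lt ((readingWord_perm L).mem_iff.1 (hs.mem (a := e) (by simp)))
      refine ⟨s ++ [e] ++ [y], ?_, ?_, by simpa using hlen, ?_⟩
      · rw [readingWord_cons]
        exact hs.append (List.singleton_sublist.2 hy)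
      · rw [List.pairwise_append]
        refine ⟨hdec, by simp, fun a ha b hb => ?_⟩
        rw [List.mem_singleton.1 hb]
        rcases List.mem_append.1 ha with ha | ha
        · exact hye.trans ((List.pairwise_append.1 hdec).2.2 a ha e (by simp))
        · rw [List.mem_singleton.1 ha]
          exact hye
      · intro a ha
        rcases List.mem_append.1 ha with ha | ha
        · exact hk a ha
        · rw [List.mem_singleton.1 ha]
          exact hye.le.trans (hk e (by simp))

/-- Schensted's theorem for decreasing subwords, for three rows. -/
theorem hasDecreasing_three_iff {k : ℕ} {w : List ℕ} (h : w.Nodup) :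
    HasDecreasing 3 k w ↔ ∃ x ∈ ((insertionTableau w).drop 2).flatten, x ≤ k := by
  rw [(KnuthEquiv.readingWord_insertionTableau h).hasDecreasing_iff]
  have hL := isTableau_insertionTableau h
  constructor
  · intro h
    have h1 := h.tail hL.pairwise_lt
    have h2 := h1.tail fun r hr => hL.pairwise_lt r (List.mem_of_mem_tail hr)
    obtain ⟨s, hs, -, hlen, hk⟩ := h2
    obtain ⟨x, rfl⟩ := List.length_eq_one_iff.1 hlen
    refine ⟨x, ?_, hk x (by simp)⟩
    have := (readingWord_perm _).mem_iff.1 (hs.mem (a := x) (by simp))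
    simpa [← List.drop_one, List.drop_drop] using this
  · rintro ⟨x, hx, hxk⟩
    exact hL.hasDecreasing hx hxk

/-! ### Reverse insertion -/

/-- The letter `y` takes the place of the largest entry below it, and that entry leaves the row as
`x`. -/
theorem exists_rowInsert_eq {y : ℕ} {l : List ℕ} (hl : l.Pairwise (· < ·)) (hy : y ∉ l)
    (h : ∃ z ∈ l, z < y) : ∃ x l', l'.Pairwise (· < ·) ∧ rowInsert x l' = (l, some y) := by
  induction l with
  | nil => simp at h
  | cons a t ih =>
    have ht := List.pairwise_cons.1 hl
    by_cases hz : ∃ z ∈ t, z < y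
    · obtain ⟨x, l', hl', hx⟩ := ih ht.2 (fun h' => hy (by simp [h'])) hz
      obtain ⟨z, hzt, hzy⟩ := hz
      have hxt : x ∈ t := by
        have := mem_rowInsert_self x l'
        rwa [hx] at this
      refine ⟨x, a :: l', List.pairwise_cons.2 ⟨fun b hb => ?_, hl'⟩, ?_⟩
      · have hp := rowInsert_perm x l'
        rw [hx] at hp
        have hb : b ∈ y :: t := hp.mem_iff.2 (by simp [hb])
        rcases List.mem_cons.1 hb with rfl | hb
        · exact (ht.1 z hzt).trans hzy
        · exact ht.1 b hb
      · rw [rowInsert_of_le _ (ht.1 x hxt).le, hx]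
    · push Not at hz
      have hay : a < y := by
        obtain ⟨z, hzm, hzy⟩ := h
        rcases List.mem_cons.1 hzm with rfl | hzm
        · exact hzy
        · exact absurd hzy (not_lt.2 (hz z hzm))
      refine ⟨a, y :: t, List.pairwise_cons.2 ⟨fun b hb => ?_, ht.2⟩, rowInsert_of_lt t hay⟩
      exact lt_of_le_of_ne (hz b hb) fun h' => hy (by simp [h', hb])

theorem rowInsert_of_forall_le {x : ℕ} {l : List ℕ} (h : ∀ a ∈ l, a ≤ x) :
    rowInsert x l = (l ++ [x], none) := by
  induction l with
  | nil => rfl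
  | cons a l ih =>
    rw [rowInsert_of_le l (h a (by simp)), ih fun b hb => h b (by simp [hb])]
    rfl

theorem IsTableau.pairwise_le_headD {L : List (List ℕ)} (h : IsTableau L) :
    (L.headD []).Pairwise (· ≤ ·) := by
  cases L with
  | nil => simp
  | cons r L => exact h.2.1.imp (fun {a b : ℕ} (h : a < b) => h.le)

theorem length_headD_eq {L L' : List (List ℕ)}
    (h : L.map List.length = L'.map List.length) :
    (L.headD []).length = (L'.headD []).length := by
  cases L <;> cases L' <;> simp_all

/-- Only the shapes before and after the insertion of `x` into `B` matter: the added cell is the one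
at which reverse insertion in `L` starts. -/
theorem exists_tableauInsert_eq {x : ℕ} {L B : List (List ℕ)} (hL : IsTableau L)
    (hnd : L.flatten.Nodup) (hB : IsTableau B)
    (h : L.map List.length = (tableauInsert x B).map List.length) :
    ∃ x' L', L'.map List.length = B.map List.length ∧ IsTableau L' ∧ tableauInsert x' L' = L := by
  induction B generalizing x L with
  | nil =>
    match L, h with
    | [[y]], _ => exact ⟨y, [], rfl, trivial, rfl⟩
  | cons r B ih =>
    rw [tableauInsert] at h
    cases L with
    | nil => split at h <;> simp at h
    | cons l L =>
    obtain ⟨h1, h2, h3, h4⟩ := hL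
    cases hy : (rowInsert x r).2 with
    | none =>
      simp only [hy, rowInsert_fst_of_none hy, List.map_cons, List.cons.injEq] at h
      obtain ⟨l, y, rfl⟩ := List.eq_nil_or_concat l |>.resolve_left h1
      rw [List.concat_eq_append] at *
      have hlen : l.length = r.length := by simpa using h.1
      have hl := List.pairwise_append.1 h2
      have hly : ∀ a ∈ l, a < y := fun a ha => hl.2.2 a ha y (by simp)
      refine ⟨y, l :: L, by simp [hlen, h.2], ⟨?_, hl.1, fun e => ?_, h4⟩, ?_⟩
      · rintro rfl
        exact hB.1 (List.length_eq_zero_iff.1 hlen.symm)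
      · have h5 := h3 e
        rw [countLT_append, countLT_cons, countLT_nil] at h5
        split_ifs at h5 with hye
        -- Here `l` is counted in full, and the shape of `B` shows that the next row is not longer.
        · rw [countLT_eq_length fun a ha => (hly a ha).trans hye, hlen]
          refine (countLT_le_length _ _).trans ?_
          rw [length_headD_eq h.2]
          exact hB.2.2.1.length_le
        · exact h5
      · simp [tableauInsert, rowInsert_of_forall_le fun a ha => (hly a ha).le]
    | some y =>
      simp only [hy, List.map_cons, List.cons.injEq] at h
      rw [List.flatten_cons] at hnd
      obtain ⟨y', L', hsh, hL', rfl⟩ := ih h4 hnd.of_append_right hB.2.2.2 h.2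
      have hmem : y' ∈ (tableauInsert y' L').headD [] := by
        rw [headD_tableauInsert]
        exact mem_rowInsert_self _ _
      have hmem' : y' ∈ (tableauInsert y' L').flatten :=
        (flatten_tableauInsert_perm y' L').mem_iff.2 (by simp)
      obtain ⟨x', l', hl', hx'⟩ := exists_rowInsert_eq h2
        (fun h' => List.disjoint_of_nodup_append hnd h' hmem') (h3.exists_lt hmem)
      have hx2 : (rowInsert x' l').2 = some y' := by rw [hx']
      have hlen : l'.length = r.length := by
        rw [← length_rowInsert_of_some hx2, hx', h.1, length_rowInsert_of_some hy]
      have hl'' := hl'.imp (fun {a b : ℕ} (h : a < b) => h.le)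
      refine ⟨x', l' :: L', by simp [hlen, hsh], ⟨?_, hl', fun e => ?_, hL'⟩, ?_⟩
      · rintro rfl
        exact hB.1 (List.length_eq_zero_iff.1 hlen.symm)
      -- Dominance before the insertion follows from dominance after it, used at `e` and at the
      -- bumped letter `y'`.
      · have hd : ∀ e, _ := fun e => h3 e
        have e1 := hd e
        have e2 := hd y'
        have hl : l = (rowInsert x' l').1 := by rw [hx']
        simp only [headD_tableauInsert, countLT_rowInsert y' hL'.pairwise_le_headD, hl,
          countLT_rowInsert x' hl''] at e1 e2
        have hxy := lt_of_rowInsert_eq_some hx2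
        have e3 := countLT_of_rowInsert_eq_some hl'' hx2
        rcases le_or_gt e y' with he | he
        · have e4 := countLT_mono (L'.headD []) (show e + 1 ≤ y' + 1 by omega)
          rcases le_or_gt e x' with he' | he'
          · split_ifs at e1 e2 <;> omega
          · have e5 := countLT_mono l' (show x' + 1 ≤ e by omega)
            split_ifs at e1 e2 <;> omega
        · have e4 := countLT_succ_le l' (mem_of_rowInsert_eq_some hx2) he
          split_ifs at e1 e2 <;> omega
      · rw [tableauInsert, hx']

/-- For every tableau `L` of the shape of the insertion tableau of `u` there is a word with
insertion tableau `L` and with the same recording tableau as `u`. -/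
theorem exists_insertionTableau_eq {u : List ℕ} (hu : u.Nodup) {L : List (List ℕ)}
    (hL : IsTableau L) (hnd : L.flatten.Nodup)
    (h : L.map List.length = (insertionTableau u).map List.length) :
    ∃ u' : List ℕ, u'.length = u.length ∧ insertionTableau u' = L ∧
      ∀ i, (insertionTableau (u'.take i)).map List.length =
        (insertionTableau (u.take i)).map List.length := by
  induction u using List.reverseRecOn generalizing L with
  | nil =>
    have : L = [] := by simpa [insertionTableau] using h
    exact ⟨[], rfl, this.symm, fun i => by simp⟩
  | append_singleton u x ih =>
    rw [insertionTableau_concat] at h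
    obtain ⟨x', L', hsh, hL', rfl⟩ := exists_tableauInsert_eq hL hnd
      (isTableau_insertionTableau hu.of_append_left) h
    have hnd' : L'.flatten.Nodup :=
      (List.nodup_cons.1 ((flatten_tableauInsert_perm x' L').nodup_iff.1 hnd)).2
    obtain ⟨u', hlen, rfl, hpre⟩ := ih hu.of_append_left hL' hnd' hsh
    refine ⟨u' ++ [x'], by simp [hlen], insertionTableau_concat _ _, fun i => ?_⟩
    rcases le_or_gt i u.length with hi | hi
    · rw [List.take_append_of_le_length hi, List.take_append_of_le_length (hlen ▸ hi)]
      exact hpre i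
    · rw [List.take_of_length_le (by simp; omega), List.take_of_length_le (by simp; omega),
        insertionTableau_concat, insertionTableau_concat, h]

/-! ### Replacing the small letters -/

/-- `B` and `B'` are the parts of the tableaux `A` and `A'` formed by the entries at most `k`;
they have the same shape, and the entries of `A` and `A'` greater than `k` are at the same
places. -/
inductive InnerReplacement (k : ℕ) :
    List (List ℕ) → List (List ℕ) → List (List ℕ) → List (List ℕ) → Prop
  | nil (A : List (List ℕ)) : (∀ x ∈ A.flatten, k < x) → InnerReplacement k A [] A []
  | cons (s s' l : List ℕ) (A B A' B' : List (List ℕ)) : s.length = s'.length →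
      (∀ x ∈ s, x ≤ k) → (∀ x ∈ s', x ≤ k) → (∀ x ∈ l, k < x) → InnerReplacement k A B A' B' →
      InnerReplacement k ((s ++ l) :: A) (s :: B) ((s' ++ l) :: A') (s' :: B')

namespace InnerReplacement

/-- A large letter passes over the small part of each row, so both insertions only see the common
large parts. -/
theorem insert_large {k y : ℕ} {A B A' B' : List (List ℕ)} (h : InnerReplacement k A B A' B')
    (hy : k < y) : InnerReplacement k (tableauInsert y A) B (tableauInsert y A') B' := by
  induction h generalizing y with
  | nil A hA =>
    refine .nil _ fun x hx => ?_
    rcases List.mem_cons.1 ((flatten_tableauInsert_perm y A).mem_iff.1 hx) with rfl | hx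
    · exact hy
    · exact hA x hx
  | cons s s' l A B A' B' hlen hs hs' hl h ih =>
    have hrow : ∀ t : List ℕ, (∀ x ∈ t, x ≤ k) →
        rowInsert y (t ++ l) = (t ++ (rowInsert y l).1, (rowInsert y l).2) := fun t ht =>
      rowInsert_append_of_none l
        (by rw [rowInsert_of_forall_le fun a ha => (ht a ha).trans hy.le])
    have hl' : ∀ x ∈ (rowInsert y l).1, k < x := fun x hx => by
      rcases mem_or_eq_of_mem_rowInsert hx with rfl | hx
      · exact hy
      · exact hl x hx
    rw [tableauInsert, tableauInsert, hrow s hs, hrow s' hs']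
    cases hq : (rowInsert y l).2 with
    | none => exact .cons s s' _ A B A' B' hlen hs hs' hl' h
    | some q =>
      exact .cons s s' _ _ B _ B' hlen hs hs' hl' (ih (hl q (mem_of_rowInsert_eq_some hq)))

/-- Equal shapes force both bumping paths through the small parts to end in the same row. There the
small part grows by a cell and pushes the first large letter of the row, if any, into the rows
below; this letter is the same in both tableaux. -/
theorem insert_small {k x x' : ℕ} {A B A' B' : List (List ℕ)} (h : InnerReplacement k A B A' B')
    (hx : x ≤ k) (hx' : x' ≤ k)
    (hsh : (tableauInsert x B).map List.length = (tableauInsert x' B').map List.length) :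
    InnerReplacement k (tableauInsert x A) (tableauInsert x B) (tableauInsert x' A')
      (tableauInsert x' B') := by
  induction h generalizing x x' with
  | nil A hA =>
    have key : ∀ (l : List ℕ) (A : List (List ℕ)), (∀ y ∈ l, k < y) → (∀ y ∈ A.flatten, k < y) →
        InnerReplacement k (([x] ++ l) :: A) [[x]] (([x'] ++ l) :: A) [[x']] := fun l A hl hA =>
      .cons [x] [x'] l A [] A [] rfl (by simpa using hx) (by simpa using hx') hl (.nil A hA)
    cases A with
    | nil => exact key [] [] (by simp) (by simp)
    | cons r A =>
      have hA' : ∀ y ∈ A.flatten, k < y := fun y hy => hA y (by simp at hy ⊢; exact Or.inr hy)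
      cases r with
      | nil => simpa [tableauInsert, rowInsert] using key [] A (by simp) hA'
      | cons y l =>
        have hy : k < y := hA y (by simp)
        have hl : ∀ z ∈ l, k < z := fun z hz => hA z (by simp [hz])
        simp only [tableauInsert, rowInsert_of_lt l (hx.trans_lt hy),
          rowInsert_of_lt l (hx'.trans_lt hy)]
        refine key l _ hl fun z hz => ?_
        rcases List.mem_cons.1 ((flatten_tableauInsert_perm y A).mem_iff.1 hz) with rfl | hz
        · exact hy
        · exact hA' z hz
  | cons s s' l A B A' B' hlen hs hs' hl h ih =>
    have hrow : ∀ {t : List ℕ} {y : ℕ}, (∀ a ∈ t, a ≤ k) → y ≤ k →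
        ∀ a ∈ (rowInsert y t).1, a ≤ k := fun ht hy a ha => by
      rcases mem_or_eq_of_mem_rowInsert ha with rfl | ha
      · exact hy
      · exact ht a ha
    have hs1 := hrow hs hx
    have hs1' := hrow hs' hx'
    rw [tableauInsert, tableauInsert] at hsh
    cases hy : (rowInsert x s).2 with
    | none =>
      cases hy' : (rowInsert x' s').2 with
      | some y' =>
        simp only [hy, hy', List.map_cons, List.cons.injEq, rowInsert_fst_of_none hy,
          length_rowInsert_of_some hy', List.length_append, List.length_singleton] at hsh
        omega
      | none =>
        rw [rowInsert_fst_of_none hy] at hs1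
        rw [rowInsert_fst_of_none hy'] at hs1'
        simp only [tableauInsert, hy, hy', rowInsert_append_of_none l hy,
          rowInsert_append_of_none l hy', rowInsert_fst_of_none hy, rowInsert_fst_of_none hy']
        have hlen' : (s ++ [x]).length = (s' ++ [x']).length := by simp [hlen]
        cases l with
        | nil =>
          simpa [rowInsert] using
            InnerReplacement.cons (s ++ [x]) (s' ++ [x']) [] A B A' B' hlen' hs1 hs1' (by simp) h
        | cons q l =>
          have hq : k < q := hl q (by simp)
          simpa [rowInsert_of_lt l (hx.trans_lt hq), rowInsert_of_lt l (hx'.trans_lt hq)] using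
            InnerReplacement.cons (s ++ [x]) (s' ++ [x']) l _ B _ B' hlen' hs1 hs1'
              (fun z hz => hl z (by simp [hz])) (h.insert_large hq)
    | some y =>
      cases hy' : (rowInsert x' s').2 with
      | none =>
        simp only [hy, hy', List.map_cons, List.cons.injEq, rowInsert_fst_of_none hy',
          length_rowInsert_of_some hy, List.length_append, List.length_singleton] at hsh
        omega
      | some y' =>
        simp only [hy, hy', List.map_cons, List.cons.injEq] at hsh
        simp only [tableauInsert, hy, hy', rowInsert_append_of_some l hy,
          rowInsert_append_of_some l hy']
        exact .cons _ _ l _ _ _ _ hsh.1 hs1 hs1' hl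
          (ih (hs y (mem_of_rowInsert_eq_some hy)) (hs' y' (mem_of_rowInsert_eq_some hy')) hsh.2)

/-- Replacing the letters at most `k` of a word, without changing the recording tableau of the
subword that they form, replaces the inner tableau of the insertion tableau. -/
theorem insertionTableau {k : ℕ} {f : ℕ → ℕ} (hlarge : ∀ x, k < x → f x = x)
    (hsmall : ∀ x ≤ k, f x ≤ k) (w : List ℕ)
    (hsh : ∀ i, (insertionTableau ((w.filter (· ≤ k)).take i)).map List.length =
      (insertionTableau (((w.filter (· ≤ k)).map f).take i)).map List.length) :
    InnerReplacement k (insertionTableau w) (insertionTableau (w.filter (· ≤ k)))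
      (insertionTableau (w.map f)) (insertionTableau ((w.filter (· ≤ k)).map f)) := by
  induction w using List.reverseRecOn with
  | nil => exact .nil [] (by simp)
  | append_singleton w x ih =>
    have ih := ih fun i => by
      rcases le_or_gt i (w.filter (· ≤ k)).length with hi | hi
      · have := hsh i
        rw [List.filter_append, List.map_append, List.take_append_of_le_length hi,
          List.take_append_of_le_length (by simpa using hi)] at this
        exact this
      · have := hsh (w.filter (· ≤ k)).length
        rw [List.filter_append, List.map_append, List.take_append_of_le_length le_rfl,
          List.take_append_of_le_length (by simp)] at this
        rw [List.take_of_length_le hi.le, List.take_of_length_le (by simpa using hi.le)]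
        rwa [List.take_of_length_le le_rfl, List.take_of_length_le (by simp)] at this
    rw [List.map_append, List.map_singleton, insertionTableau_concat, insertionTableau_concat]
    rcases le_or_gt x k with hx | hx
    · have h1 : (w ++ [x]).filter (· ≤ k) = w.filter (· ≤ k) ++ [x] := by simp [hx]
      have := hsh ((w ++ [x]).filter (· ≤ k)).length
      rw [List.take_of_length_le le_rfl, List.take_of_length_le (by simp), h1, List.map_append,
        List.map_singleton, insertionTableau_concat, insertionTableau_concat] at this
      rw [h1, List.map_append, List.map_singleton, insertionTableau_concat,
        insertionTableau_concat]
      exact ih.insert_small hx (hsmall x hx) this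
    · have h1 : (w ++ [x]).filter (· ≤ k) = w.filter (· ≤ k) := by simp [hx]
      rw [h1, hlarge x hx]
      exact ih.insert_large hx

theorem insertionTableau_filter (k : ℕ) (w : List ℕ) :
    InnerReplacement k (_root_.insertionTableau w) (_root_.insertionTableau (w.filter (· ≤ k)))
      (_root_.insertionTableau w) (_root_.insertionTableau (w.filter (· ≤ k))) := by
  simpa using insertionTableau (k := k) (f := id) (fun _ _ => rfl) (fun _ h => h) w (by simp)

end InnerReplacement

/-- The entry of a list of rows in the row `i` and the column `j`, or `0` if there is none. -/
def rowsEntry (L : List (List ℕ)) (i j : ℕ) : ℕ := (L.getD i []).getD j 0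

theorem InnerReplacement.rowsEntry {k : ℕ} {A B A' B' : List (List ℕ)}
    (h : InnerReplacement k A B A' B') (i j : ℕ) :
    (j < (B.getD i []).length ∧ j < (B'.getD i []).length ∧
      rowsEntry A i j = rowsEntry B i j ∧ rowsEntry A' i j = rowsEntry B' i j ∧
      rowsEntry A i j ≤ k) ∨
    ((B.getD i []).length ≤ j ∧ (B'.getD i []).length ≤ j ∧
      rowsEntry A' i j = rowsEntry A i j ∧ (rowsEntry A i j = 0 ∨ k < rowsEntry A i j)) := by
  have large : ∀ (l : List ℕ) (j : ℕ), (∀ x ∈ l, k < x) → l.getD j 0 = 0 ∨ k < l.getD j 0 := by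
    intro l j hl
    rcases lt_or_ge j l.length with hj | hj
    · rw [List.getD_eq_getElem _ _ hj]
      exact Or.inr (hl _ (List.getElem_mem hj))
    · exact Or.inl (List.getD_eq_default _ _ hj)
  induction h generalizing i with
  | nil A hA =>
    refine Or.inr ⟨by simp, by simp, rfl, large _ j fun x hx => ?_⟩
    rcases lt_or_ge i A.length with hi | hi
    · rw [List.getD_eq_getElem _ _ hi] at hx
      exact hA x (List.mem_flatten.2 ⟨_, List.getElem_mem hi, hx⟩)
    · rw [List.getD_eq_default _ _ hi] at hx
      simp at hx
  | cons s s' l A B A' B' hlen hs hs' hl h ih =>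
    cases i with
    | succ i => simpa [_root_.rowsEntry] using ih i
    | zero =>
      simp only [_root_.rowsEntry, List.getD_cons_zero]
      rcases lt_or_ge j s.length with hj | hj
      · left
        have hj' : j < s'.length := hlen ▸ hj
        rw [List.getD_append _ _ _ _ hj, List.getD_append _ _ _ _ hj']
        refine ⟨hj, hj', rfl, rfl, ?_⟩
        rw [List.getD_eq_getElem _ _ hj]
        exact hs _ (List.getElem_mem hj)
      · right
        have hj' : s'.length ≤ j := hlen ▸ hj
        rw [List.getD_append_right _ _ _ _ hj, List.getD_append_right _ _ _ _ hj', hlen]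
        exact ⟨hlen ▸ hj, hj', rfl, large _ _ hl⟩

theorem exists_map_eq {k : ℕ} {u u' : List ℕ} (hu : u.Nodup) (hlen : u'.length = u.length)
    (hk : ∀ x ∈ u, x ≤ k) (hk' : ∀ x ∈ u', x ≤ k) :
    ∃ f : ℕ → ℕ, (∀ x, k < x → f x = x) ∧ (∀ x ≤ k, f x ≤ k) ∧ u.map f = u' := by
  classical
  refine ⟨fun x => if x ∈ u then u'.getD (u.idxOf x) 0 else x, fun x hx => ?_, fun x hx => ?_, ?_⟩
  · exact if_neg fun h => absurd (hk x h) (not_le.2 hx)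
  · dsimp only
    split_ifs with h
    · have : u.idxOf x < u'.length := hlen ▸ List.idxOf_lt_length_of_mem h
      rw [List.getD_eq_getElem _ _ this]
      exact hk' _ (List.getElem_mem this)
    · exact hx
  · apply List.ext_getElem (by simp [hlen])
    intro i h1 h2
    have hi : i < u.length := by simpa using h1
    simp only [List.getElem_map, List.getElem_mem, if_true]
    rw [hu.idxOf_getElem, List.getD_eq_getElem _ _ h2]

/-! ### Exchanging two small letters -/

theorem IsTableau.exists_headD_le {L : List (List ℕ)} (h : IsTableau L) {x : ℕ}
    (hx : x ∈ L.flatten) : ∃ y ∈ L.headD [], y ≤ x := by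
  cases L with
  | nil => simp at hx
  | cons r L =>
    rw [List.flatten_cons, List.mem_append] at hx
    rcases hx with hx | hx
    · exact ⟨x, hx, le_rfl⟩
    · obtain ⟨y, hy, hyx⟩ := h.exists_lt hx
      exact ⟨y, hy, hyx.le⟩

theorem mem_of_mem_headD_insertionTableau {w : List ℕ} {x : ℕ}
    (h : x ∈ (insertionTableau w).headD []) : x ∈ w := by
  rw [← (flatten_insertionTableau_perm w).mem_iff]
  cases hL : insertionTableau w with
  | nil => simp [hL] at h
  | cons r L =>
    rw [hL] at h
    exact List.mem_append_left _ h

theorem pairwise_lt_headD_insertionTableau {w : List ℕ} (h : w.Nodup) :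
    ((insertionTableau w).headD []).Pairwise (· < ·) := by
  have := pairwise_lt_insertionTableau h
  cases hL : insertionTableau w with
  | nil => simp
  | cons r L => exact this r (by simp [hL])

theorem KnuthEquiv.firstRowCount_eq {w w' : List ℕ} (h : KnuthEquiv w w') (e : ℕ) :
    firstRowCount w e = firstRowCount w' e := by
  rw [firstRowCount, firstRowCount, h.insertionTableau_eq]

/-- Exchanging adjacent letters `a < b` of which neither the first row of the insertion tableau of
the letters before them nor the letters after them separate the values shortens the part of the
first row formed by the entries at most `b`. -/
theorem firstRowCount_swap_lt {w v : List ℕ} {a b : ℕ} (hab : a < b)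
    (hw : ∀ z ∈ (insertionTableau w).headD [], z ≤ a ∨ b < z) (hv : ∀ z ∈ v, b < z) :
    firstRowCount (w ++ b :: a :: v) (b + 1) < firstRowCount (w ++ a :: b :: v) (b + 1) := by
  have h1 : w ++ a :: b :: v = (w ++ [a, b]) ++ v := by simp
  have h2 : w ++ b :: a :: v = (w ++ [b, a]) ++ v := by simp
  have h3 : firstRowCount w (a + 1) = firstRowCount w (b + 1) := by
    apply List.countP_congr
    intro z hz
    have := hw z hz
    simp only [decide_eq_true_eq]
    omega
  rw [h1, h2, firstRowCount_append_of_le _ (e := b + 1) hv,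
    firstRowCount_append_of_le _ (e := b + 1) hv]
  simp only [firstRowCount_append_pair, firstRowCount_concat, h3]
  split_ifs <;> omega

theorem exists_large_of_swap {k : ℕ} {w v : List ℕ} {a b : ℕ} (hnd : (w ++ a :: b :: v).Nodup)
    (hab : a < b) (hbk : b ≤ k)
    (hrow : ∀ e ≤ k + 1, firstRowCount (w ++ a :: b :: v) e = firstRowCount (w ++ b :: a :: v) e)
    (hdec : ¬ HasDecreasing 3 k (w ++ b :: a :: v)) :
    insertionTableau (w ++ a :: b :: v) = insertionTableau (w ++ b :: a :: v) ∨
      ∃ w' c q v', c ≤ k ∧ k < q ∧ KnuthEquiv (w ++ a :: b :: v) (w' ++ c :: q :: v') ∧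
        KnuthEquiv (w ++ b :: a :: v) (w' ++ q :: c :: v') := by
  induction hm : v.length using Nat.strong_induction_on generalizing w v a b with
  -- The induction is on the number of letters behind the pair. The hypotheses on first rows and
  -- decreasing subwords are Knuth invariant, so they pass to the new words.
  | _ m ih =>
  have hndw : w.Nodup := hnd.of_append_left
  have hndabv : (a :: b :: v).Nodup := hnd.of_append_right
  have hndv : v.Nodup := (List.nodup_cons.1 (List.nodup_cons.1 hndabv).2).2
  have haw : a ∉ w := fun h => List.disjoint_of_nodup_append hnd h (by simp)
  have hbw : b ∉ w := fun h => List.disjoint_of_nodup_append hnd h (by simp)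
  have hav : a ∉ v := fun h => (List.nodup_cons.1 hndabv).1 (by simp [h])
  have hbv : b ∉ v := (List.nodup_cons.1 (List.nodup_cons.1 hndabv).2).1
  -- Bring the first row of the tableau of `w` directly in front of the pair; an entry between `a`
  -- and `b` makes the two insertions commute up to the order of the bumped letters.
  by_cases hA : ∃ z ∈ (insertionTableau w).headD [], a < z ∧ z < b
  · obtain ⟨X, hX⟩ := KnuthEquiv.exists_append_headD hndw
    have hsub := fun x => @mem_of_mem_headD_insertionTableau w x
    have hsort := pairwise_lt_headD_insertionTableau hndw
    generalize (insertionTableau w).headD [] = r at *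
    obtain ⟨z, hz, haz, hzb, r', k1, k2⟩ := KnuthEquiv.row_append_pair hab hsort
      (fun h => haw (hsub a h)) (fun h => hbw (hsub b h)) hA
    have g1 := (hX.append_right ([a, b] ++ v)).trans
      (by simpa using k1.append X v)
    have g2 := (hX.append_right ([b, a] ++ v)).trans
      (by simpa using k2.append X v)
    cases hy : (rowInsert b r).2 with
    | none =>
      rw [hy] at g1 g2
      left
      have g1 := g1.insertionTableau_eq
      have g2 := g2.insertionTableau_eq
      simp only [Option.toList_none, List.nil_append, List.cons_append] at g1 g2
      rw [g1, g2]
    | some y =>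
      rw [hy] at g1 g2
      right
      have hby := lt_of_rowInsert_eq_some hy
      have hyk : k < y := by
        by_contra hyk
        exact hdec (hasDecreasing_three_of_mem_left (hsub y (mem_of_rowInsert_eq_some hy)) hab hby
          (not_lt.1 hyk))
      exact ⟨X, z, y, r' ++ v, (hzb.le.trans hbk), hyk, by simpa using g1, by simpa using g2⟩
  -- A later letter below `a` would complete `b a` to a decreasing subword of small letters.
  have hva : ∀ x ∈ v, a < x := fun x hx => by
    by_contra hxa
    have hxa' : x ≠ a := fun h => hav (h ▸ hx)
    exact hdec (hasDecreasing_three_of_mem_right hx hab (by omega) hbk)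
  by_cases hB : ∃ z ∈ v, z < b
  · obtain ⟨z, hz, hzb⟩ := hB
    have hndr : v.reverse.Nodup := List.nodup_reverse.2 hndv
    obtain ⟨Y, hY⟩ := KnuthEquiv.exists_append_headD hndr
    -- In the reversed word `v` precedes the pair. The first row of its tableau has an entry at most
    -- `z < b`, and this entry exceeds `a` because all letters of `v` do.
    obtain ⟨y, hy, hyz⟩ := (isTableau_insertionTableau hndr).exists_headD_le
      ((flatten_insertionTableau_perm v.reverse).mem_iff.2 (List.mem_reverse.2 hz))
    have hsub := fun x (h : x ∈ (insertionTableau v.reverse).headD []) =>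
      List.mem_reverse.1 (mem_of_mem_headD_insertionTableau h)
    have hsort := pairwise_lt_headD_insertionTableau hndr
    generalize (insertionTableau v.reverse).headD [] = r at *
    obtain ⟨c, hc, hac, hcb, r', k1, k2⟩ := KnuthEquiv.row_append_pair hab hsort
      (fun h => hav (hsub a h)) (fun h => hbv (hsub b h))
      ⟨y, hy, hva y (hsub y hy), hyz.trans_lt hzb⟩
    have g1 := ((hY.append_right ([b, a] ++ w.reverse)).trans
      (by simpa using k2.append Y w.reverse)).reverse
    have g2 := ((hY.append_right ([a, b] ++ w.reverse)).trans
      (by simpa using k1.append Y w.reverse)).reverse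
    cases hq : (rowInsert b r).2 with
    | none =>
      rw [hq] at g1 g2
      left
      have g1 := g1.insertionTableau_eq
      have g2 := g2.insertionTableau_eq
      simp at g1 g2
      rw [g1, g2]
    | some q =>
      rw [hq] at g1 g2
      have hbq := lt_of_rowInsert_eq_some hq
      have g1 : KnuthEquiv (w ++ a :: b :: v) ((w ++ r'.reverse) ++ c :: q :: Y.reverse) := by
        simpa using g1
      have g2 : KnuthEquiv (w ++ b :: a :: v) ((w ++ r'.reverse) ++ q :: c :: Y.reverse) := by
        simpa using g2
      rcases le_or_gt q k with hqk | hqk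
      -- The row `r` has left the part behind the pair, and it is not empty since it contains `c`.
      · have hlt : Y.reverse.length < m := by
          have h1 := hY.perm.length_eq
          have h2 := List.length_pos_of_mem hc
          simp at h1 ⊢
          omega
        have := ih _ hlt (g1.perm.nodup_iff.1 hnd) (hcb.trans hbq) hqk
          (fun e he => by rw [← g1.firstRowCount_eq, ← g2.firstRowCount_eq]; exact hrow e he)
          (by rwa [← g2.hasDecreasing_iff]) rfl
        rcases this with h | ⟨w', c', q', v', h1, h2, h3, h4⟩
        · left
          rw [g1.insertionTableau_eq, g2.insertionTableau_eq, h]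
        · exact Or.inr ⟨w', c', q', v', h1, h2, g1.trans h3, g2.trans h4⟩
      · exact Or.inr ⟨_, c, q, _, hcb.le.trans hbk, hqk, g1, g2⟩
  · exfalso
    -- Nothing separates `a` from `b`, so the exchange changes the number of entries at most `b` in
    -- the first row.
    have := firstRowCount_swap_lt hab (w := w) (v := v) (fun z hz => ?_) fun z hz => ?_
    · exact this.ne (hrow (b + 1) (by omega)).symm
    · by_contra hz'
      have hzb : z ≠ b := fun h => hbw (h ▸ mem_of_mem_headD_insertionTableau hz)
      exact hA ⟨z, hz, by omega, by omega⟩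
    · have hzb : z ≠ b := fun h => hbv (h ▸ hz)
      exact lt_of_le_of_ne (not_lt.1 fun h => hB ⟨z, hz, h⟩) hzb.symm

/-! ### Standard Young tableaux and lists of rows -/

theorem countLT_getElem {r : List ℕ} (hr : r.Pairwise (· < ·)) {j : ℕ} (hj : j < r.length) :
    countLT r r[j] = j := by
  induction r generalizing j with
  | nil => simp at hj
  | cons a t ih =>
    have h := List.pairwise_cons.1 hr
    cases j with
    | zero => exact countLT_eq_zero (by simpa using fun b hb => (h.1 b hb).le)
    | succ j =>
      have hj' : j < t.length := by simpa using hj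
      simp [countLT_cons, ih h.2 hj', h.1 _ (List.getElem_mem hj')]

theorem RowDominates.getElem_lt {r r' : List ℕ} (h : RowDominates r r')
    (hr : r.Pairwise (· < ·)) (hr' : r'.Pairwise (· < ·)) {j : ℕ} (hj : j < r'.length) :
    r[j]'(hj.trans_le h.length_le) < r'[j] := by
  by_contra hlt
  have h1 := h r'[j]
  have h2 := countLT_succ_le r' (List.getElem_mem hj) (Nat.lt_add_one _)
  have h3 := countLT_mono r (not_lt.1 hlt)
  rw [countLT_getElem hr' hj] at h2
  rw [countLT_getElem hr (hj.trans_le h.length_le)] at h3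
  omega

theorem isTableau_of_getD {L : List (List ℕ)} (h : ∀ i < L.length, L.getD i [] ≠ [] ∧
    (L.getD i []).Pairwise (· < ·) ∧ RowDominates (L.getD i []) (L.getD (i + 1) [])) :
    IsTableau L := by
  induction L with
  | nil => trivial
  | cons r L ih =>
    have h0 := h 0 (by simp)
    refine ⟨h0.1, h0.2.1, ?_, ih fun i hi => ?_⟩
    · have := h0.2.2
      cases L <;> simpa using this
    · simpa using h (i + 1) (by simpa using hi)

theorem IsTableau.getD {L : List (List ℕ)} (h : IsTableau L) (i : ℕ) :
    (L.getD i []).Pairwise (· < ·) ∧ RowDominates (L.getD i []) (L.getD (i + 1) []) := by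
  induction L generalizing i with
  | nil => simpa using RowDominates.nil []
  | cons r L ih =>
    cases i with
    | zero =>
      refine ⟨h.2.1, ?_⟩
      have := h.2.2.1
      cases L <;> simpa using this
    | succ i => simpa using ih h.2.2.2 i

theorem IsTableau.ne_nil {L : List (List ℕ)} (h : IsTableau L) : ∀ r ∈ L, r ≠ [] := by
  induction L with
  | nil => simp
  | cons r L ih => simpa [h.1] using ih h.2.2.2

theorem rowDominates_map_range {m m' : ℕ} (hm : m' ≤ m) {f g : ℕ → ℕ}
    (h : ∀ j < m', f j < g j) :
    RowDominates ((List.range m).map f) ((List.range m').map g) := by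
  intro e
  have h1 : countLT ((List.range m').map g) (e + 1) ≤ countLT ((List.range m').map f) e := by
    simp only [countLT, List.countP_map]
    apply List.countP_mono_left
    intro j hj
    have := h j (List.mem_range.1 hj)
    simp only [Function.comp, decide_eq_true_eq]
    omega
  exact h1.trans (((List.range_sublist.2 hm).map f).countP_le)

theorem mem_flatten_iff_rowsEntry {L : List (List ℕ)} {x : ℕ} :
    x ∈ L.flatten ↔ ∃ i j, j < (L.getD i []).length ∧ rowsEntry L i j = x := by
  rw [List.mem_flatten]
  constructor
  · rintro ⟨r, hr, hx⟩
    obtain ⟨i, hi, rfl⟩ := List.getElem_of_mem hr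
    obtain ⟨j, hj, rfl⟩ := List.getElem_of_mem hx
    refine ⟨i, j, ?_, ?_⟩
    · rwa [List.getD_eq_getElem _ _ hi]
    · rw [rowsEntry, List.getD_eq_getElem _ _ hi, List.getD_eq_getElem _ _ hj]
  · rintro ⟨i, j, hj, rfl⟩
    rcases lt_or_ge i L.length with hi | hi
    · rw [rowsEntry, List.getD_eq_getElem _ _ hj]
      rw [List.getD_eq_getElem _ _ hi] at hj
      refine ⟨_, List.getElem_mem hi, ?_⟩
      simp only [List.getD_eq_getElem _ _ hi]
      exact List.getElem_mem hj
    · rw [List.getD_eq_default _ _ hi] at hj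
      simp at hj

theorem rowsEntry_of_length_le {L : List (List ℕ)} {i j : ℕ} (h : (L.getD i []).length ≤ j) :
    rowsEntry L i j = 0 := List.getD_eq_default _ _ h

theorem rowsEntry_ne_zero {L : List (List ℕ)} (hpos : ∀ x ∈ L.flatten, 0 < x) {i j : ℕ} :
    rowsEntry L i j ≠ 0 ↔ j < (L.getD i []).length := by
  constructor
  · intro h
    by_contra hj
    exact h (rowsEntry_of_length_le (not_lt.1 hj))
  · intro h
    exact (hpos _ (mem_flatten_iff_rowsEntry.2 ⟨i, j, h, rfl⟩)).ne'

theorem rowsEntry_injective {L : List (List ℕ)} (hnd : L.flatten.Nodup) {i j i' j' : ℕ}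
    (hj : j < (L.getD i []).length) (hj' : j' < (L.getD i' []).length)
    (h : rowsEntry L i j = rowsEntry L i' j') : i = i' ∧ j = j' := by
  have hlt : ∀ {i j : ℕ}, j < (L.getD i []).length → i < L.length := by
    intro i j hj
    by_contra hi
    rw [List.getD_eq_default _ _ (not_lt.1 hi)] at hj
    simp at hj
  have hi := hlt hj
  have hi' := hlt hj'
  simp only [rowsEntry, List.getD_eq_getElem _ _ hj, List.getD_eq_getElem _ _ hj'] at h
  simp only [List.getD_eq_getElem _ _ hi, List.getD_eq_getElem _ _ hi'] at h hj hj'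
  rw [List.nodup_flatten] at hnd
  have hii : i = i' := by
    by_contra hne
    rcases Nat.lt_or_gt_of_ne hne with hlt | hlt
    · exact List.pairwise_iff_getElem.1 hnd.2 i i' hi hi' hlt (List.getElem_mem hj)
        (h ▸ List.getElem_mem hj')
    · exact List.pairwise_iff_getElem.1 hnd.2 i' i hi' hi hlt (List.getElem_mem hj')
        (h ▸ List.getElem_mem hj)
  subst hii
  exact ⟨rfl, ((hnd.1 _ (List.getElem_mem hi)).getElem_inj_iff).1 h⟩

/-- A word is standard if it contains each of the letters `1, …, n` once. -/
def IsStandardWord (n : ℕ) (w : List ℕ) : Prop := w.Nodup ∧ ∀ x, x ∈ w ↔ 1 ≤ x ∧ x ≤ n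

theorem IsStandardWord.perm {n : ℕ} {w w' : List ℕ} (h : IsStandardWord n w) (hp : w.Perm w') :
    IsStandardWord n w' :=
  ⟨hp.nodup_iff.1 h.1, fun x => by rw [← hp.mem_iff, h.2]⟩

namespace SYT

variable {n k : ℕ}

theorem mem_shape_iff (T : SYT n) {i j : ℕ} : (i, j) ∈ T.shape ↔ T.entry i j ≠ 0 :=
  ⟨fun h => Nat.pos_iff_ne_zero.1 (T.entry_pos h), fun h => by
    by_contra h'
    exact h (T.entry_eq_zero i j h')⟩

theorem ext_entry {S T : SYT n} (h : ∀ i j, S.entry i j = T.entry i j) : S = T := by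
  apply SYT.ext
  · apply SetLike.ext
    rintro ⟨i, j⟩
    rw [mem_shape_iff, mem_shape_iff, h]
  · funext i j
    exact h i j

theorem length_rows (T : SYT n) : T.rows.length = T.shape.colLen 0 := by simp [rows]

theorem getD_rows (T : SYT n) (i : ℕ) :
    T.rows.getD i [] = (List.range (T.shape.rowLen i)).map (T.entry i) := by
  rcases lt_or_ge i (T.shape.colLen 0) with hi | hi
  · rw [List.getD_eq_getElem _ _ (by rwa [length_rows])]
    simp [rows]
  · rw [List.getD_eq_default _ _ (by rwa [length_rows])]
    have h : (i, 0) ∉ T.shape := fun h => absurd (YoungDiagram.mem_iff_lt_colLen.1 h) (not_lt.2 hi)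
    rw [YoungDiagram.mem_iff_lt_rowLen] at h
    simp [Nat.eq_zero_of_not_pos h]

theorem mem_shape_iff_lt_length (T : SYT n) {i j : ℕ} :
    (i, j) ∈ T.shape ↔ j < (T.rows.getD i []).length := by
  rw [getD_rows, YoungDiagram.mem_iff_lt_rowLen]
  simp

theorem rowsEntry_rows (T : SYT n) (i j : ℕ) : rowsEntry T.rows i j = T.entry i j := by
  by_cases h : (i, j) ∈ T.shape
  · have h' := T.mem_shape_iff_lt_length.1 h
    rw [rowsEntry, List.getD_eq_getElem _ _ h']
    simp only [getD_rows, List.getElem_map, List.getElem_range]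
  · rw [T.entry_eq_zero i j h, rowsEntry_of_length_le]
    exact not_lt.1 (mt T.mem_shape_iff_lt_length.2 h)

theorem rows_injective : Function.Injective (rows : SYT n → List (List ℕ)) := fun S T h =>
  ext_entry fun i j => by rw [← rowsEntry_rows, ← rowsEntry_rows, h]

theorem isTableau_rows (T : SYT n) : IsTableau T.rows := by
  refine isTableau_of_getD fun i hi => ?_
  rw [getD_rows, getD_rows]
  rw [length_rows, ← YoungDiagram.mem_iff_lt_colLen, YoungDiagram.mem_iff_lt_rowLen] at hi
  refine ⟨?_, ?_, ?_⟩
  · simpa using hi.ne'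
  · rw [List.pairwise_map]
    refine (List.pairwise_lt_range).imp_of_mem fun {a b} _ hb hab => ?_
    exact T.row_lt i a b hab (YoungDiagram.mem_iff_lt_rowLen.2 (List.mem_range.1 hb))
  · refine rowDominates_map_range (T.shape.rowLen_anti _ _ (Nat.le_succ i)) fun j hj => ?_
    exact T.col_lt i (i + 1) j (Nat.lt_succ_self i) (YoungDiagram.mem_iff_lt_rowLen.2 hj)

theorem mem_flatten_rows (T : SYT n) {x : ℕ} : x ∈ T.rows.flatten ↔ 1 ≤ x ∧ x ≤ n := by
  rw [mem_flatten_iff_rowsEntry]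
  constructor
  · rintro ⟨i, j, hj, rfl⟩
    rw [← mem_shape_iff_lt_length] at hj
    rw [rowsEntry_rows]
    exact ⟨T.entry_pos hj, T.entry_le hj⟩
  · intro hx
    obtain ⟨⟨i, j⟩, hc, he⟩ := T.bijOn.surjOn hx
    exact ⟨i, j, T.mem_shape_iff_lt_length.1 hc, by rw [rowsEntry_rows]; exact he⟩

theorem nodup_flatten_rows (T : SYT n) : T.rows.flatten.Nodup := by
  rw [List.nodup_flatten]
  refine ⟨fun r hr => (T.isTableau_rows.pairwise_lt r hr).imp fun h => h.ne, ?_⟩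
  rw [List.pairwise_iff_getElem]
  intro i i' hi hi' hlt x hx hx'
  rw [← List.getD_eq_getElem _ [] hi, getD_rows, List.mem_map] at hx
  rw [← List.getD_eq_getElem _ [] hi', getD_rows, List.mem_map] at hx'
  obtain ⟨j, hj, rfl⟩ := hx
  obtain ⟨j', hj', he⟩ := hx'
  rw [List.mem_range, ← YoungDiagram.mem_iff_lt_rowLen] at hj hj'
  have := T.bijOn.injOn hj' hj he
  simp at this
  omega

theorem isStandardWord_flatten_rows (T : SYT n) : IsStandardWord n T.rows.flatten :=
  ⟨T.nodup_flatten_rows, fun _ => T.mem_flatten_rows⟩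

theorem isStandardWord_of_rows_eq {T : SYT n} {w : List ℕ} (h : T.rows = insertionTableau w) :
    IsStandardWord n w :=
  T.isStandardWord_flatten_rows.perm (h ▸ flatten_insertionTableau_perm w)

/-- All genuine entries are positive, so the value `0` shows where a row ends; without empty rows
this also fixes the number of rows. -/
theorem rows_eq_of_entry {T : SYT n} {L : List (List ℕ)} (hne : ∀ r ∈ L, r ≠ [])
    (hpos : ∀ x ∈ L.flatten, 0 < x) (h : ∀ i j, T.entry i j = rowsEntry L i j) : T.rows = L := by
  have hlen : ∀ i j, j < (T.rows.getD i []).length ↔ j < (L.getD i []).length := fun i j => by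
    rw [← mem_shape_iff_lt_length, mem_shape_iff, h, rowsEntry_ne_zero hpos]
  have hrow : ∀ i, T.rows.getD i [] = L.getD i [] := fun i => by
    apply List.ext_getElem (eq_of_forall_lt_iff (hlen i))
    intro j h1 h2
    have := h i j
    rwa [← rowsEntry_rows, rowsEntry, rowsEntry, List.getD_eq_getElem _ _ h1,
      List.getD_eq_getElem _ _ h2] at this
  have hlt : ∀ {L : List (List ℕ)}, (∀ r ∈ L, r ≠ []) → ∀ i, i < L.length ↔ L.getD i [] ≠ [] := by
    intro L hL i
    constructor
    · intro hi
      rw [List.getD_eq_getElem _ _ hi]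
      exact hL _ (List.getElem_mem hi)
    · intro hi
      by_contra hi'
      exact hi (List.getD_eq_default _ _ (not_lt.1 hi'))
  apply List.ext_getElem
  · apply eq_of_forall_lt_iff
    intro i
    rw [hlt T.isTableau_rows.ne_nil, hlt hne, hrow]
  · intro i h1 h2
    rw [← List.getD_eq_getElem _ [] h1, ← List.getD_eq_getElem _ [] h2, hrow]

theorem exists_rows_eq {L : List (List ℕ)} (hL : IsTableau L)
    (hst : IsStandardWord n L.flatten) : ∃ T : SYT n, T.rows = L := by
  have hanti : ∀ i i', i ≤ i' → (L.getD i' []).length ≤ (L.getD i []).length := by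
    intro i i' h
    induction h with
    | refl => exact le_rfl
    | step _ ih => exact (hL.getD _).2.length_le.trans ih
  have hlt : ∀ {i j : ℕ}, j < (L.getD i []).length → i < L.length := by
    intro i j hj
    by_contra hi
    rw [List.getD_eq_default _ _ (not_lt.1 hi)] at hj
    simp at hj
  let D : YoungDiagram :=
    -- The rectangle serves to make the set of cells finite; the first row is the longest.
    { cells := (Finset.range L.length ×ˢ Finset.range (L.getD 0 []).length).filter
        fun c => c.2 < (L.getD c.1 []).length
      isLowerSet := by
        rintro ⟨i₂, j₂⟩ ⟨i₁, j₁⟩ hle hmem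
        simp only [Finset.coe_filter, Finset.mem_product, Finset.mem_range,
          Set.mem_ofPred_eq] at hmem ⊢
        have h1 : i₁ ≤ i₂ := hle.1
        have h2 : j₁ ≤ j₂ := hle.2
        exact ⟨⟨by omega, by omega⟩, (h2.trans_lt hmem.2).trans_le (hanti _ _ h1)⟩ }
  have hD : ∀ i j, (i, j) ∈ D ↔ j < (L.getD i []).length := by
    intro i j
    rw [← YoungDiagram.mem_cells]
    simp only [D, Finset.mem_filter, Finset.mem_product, Finset.mem_range]
    exact ⟨fun h => h.2, fun h => ⟨⟨hlt h, h.trans_le (hanti _ _ (Nat.zero_le i))⟩, h⟩⟩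
  have hrow : ∀ i j₁ j₂, j₁ < j₂ → (i, j₂) ∈ D → rowsEntry L i j₁ < rowsEntry L i j₂ := by
    intro i j₁ j₂ hj h
    rw [hD] at h
    rw [rowsEntry, rowsEntry, List.getD_eq_getElem _ _ h, List.getD_eq_getElem _ _ (hj.trans h)]
    exact List.pairwise_iff_getElem.1 (hL.getD i).1 j₁ j₂ _ _ hj
  have hcol : ∀ i₁ i₂ j, i₁ < i₂ → (i₂, j) ∈ D → rowsEntry L i₁ j < rowsEntry L i₂ j := by
    intro i₁ i₂ j hi
    have step : ∀ i, (i + 1, j) ∈ D → rowsEntry L i j < rowsEntry L (i + 1) j := by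
      intro i h
      rw [hD] at h
      have hd := (hL.getD i).2
      rw [rowsEntry, rowsEntry, List.getD_eq_getElem _ _ h,
        List.getD_eq_getElem _ _ (h.trans_le hd.length_le)]
      exact hd.getElem_lt (hL.getD i).1 (hL.getD (i + 1)).1 h
    induction i₂, hi using Nat.le_induction with
    | base => exact step i₁
    | succ i₂ _ ih =>
      intro h
      exact (ih (D.up_left_mem (Nat.le_succ i₂) le_rfl h)).trans (step i₂ h)
  have hpos : ∀ x ∈ L.flatten, 0 < x := fun x hx => ((hst.2 x).1 hx).1
  refine ⟨⟨D, rowsEntry L, fun i j h => rowsEntry_of_length_le (not_lt.1 (mt (hD i j).2 h)),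
    ⟨?_, ?_, ?_⟩, hrow, hcol⟩, rows_eq_of_entry hL.ne_nil hpos fun _ _ => rfl⟩
  · rintro ⟨i, j⟩ h
    exact (hst.2 _).1 (mem_flatten_iff_rowsEntry.2 ⟨i, j, (hD i j).1 h, rfl⟩)
  · rintro ⟨i, j⟩ h ⟨i', j'⟩ h' he
    obtain ⟨rfl, rfl⟩ := rowsEntry_injective hst.1 ((hD i j).1 h) ((hD i' j').1 h') he
    rfl
  · intro x hx
    obtain ⟨i, j, hj, he⟩ := mem_flatten_iff_rowsEntry.1 ((hst.2 x).2 hx)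
    exact ⟨(i, j), (hD i j).2 hj, he⟩

theorem exists_rows_eq_insertionTableau {w : List ℕ} (hw : IsStandardWord n w) :
    ∃ T : SYT n, T.rows = insertionTableau w :=
  exists_rows_eq (isTableau_insertionTableau hw.1)
    (hw.perm (flatten_insertionTableau_perm w).symm)

theorem map_length_rows_eq {R R' : SYT n} (h : R.shape = R'.shape) :
    R.rows.map List.length = R'.rows.map List.length := by
  simp [rows, h, Function.comp_def]

/-! ### Inner tableaux of insertion tableaux -/

/-- This is inner replacement for the identity map of letters: large letters do not disturb the
tableau of the small ones. -/
theorem rows_inner {T : SYT n} {w : List ℕ} (h : T.rows = insertionTableau w) (hk : k ≤ n) :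
    (T.inner k hk).rows = insertionTableau (w.filter (· ≤ k)) := by
  have hw := isStandardWord_of_rows_eq h
  have hpos : ∀ x ∈ (insertionTableau (w.filter (· ≤ k))).flatten, 0 < x := fun x hx =>
    ((hw.2 x).1 (List.mem_of_mem_filter ((flatten_insertionTableau_perm _).mem_iff.1 hx))).1
  refine rows_eq_of_entry (isTableau_insertionTableau (hw.1.filter _)).ne_nil hpos fun i j => ?_
  change (if (i, j) ∈ T.innerShape k then T.entry i j else 0) = _
  have hmem := T.mem_innerShape k (i := i) (j := j)
  rw [mem_shape_iff, ← rowsEntry_rows, h] at hmem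
  rw [← rowsEntry_rows, h]
  rcases (InnerReplacement.insertionTableau_filter k w).rowsEntry i j with
    ⟨h1, -, h3, -, h5⟩ | ⟨h1, -, -, h4⟩
  · rw [if_pos (hmem.2 ⟨?_, h5⟩), h3]
    rw [h3]
    exact (rowsEntry_ne_zero hpos).2 h1
  · rw [if_neg (mt hmem.1 ?_), rowsEntry_of_length_le h1]
    omega

theorem rows_replaceInner {hk : k ≤ n} {R R' : SYT k} (hsh : R.shape = R'.shape)
    (T : WithInner hk R) {A' : List (List ℕ)} (hA' : IsTableau A')
    (hpos : ∀ x ∈ A'.flatten, 0 < x) (h : InnerReplacement k T.1.rows R.rows A' R'.rows) :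
    (replaceInner hsh T).rows = A' := by
  refine rows_eq_of_entry hA'.ne_nil hpos fun i j => ?_
  change (if (i, j) ∈ R.shape then R'.entry i j else T.1.entry i j) = _
  have hmem := R.mem_shape_iff_lt_length (i := i) (j := j)
  rcases h.rowsEntry i j with ⟨h1, -, -, h4, -⟩ | ⟨h1, -, h3, -⟩
  · rw [if_pos (hmem.2 h1), h4, rowsEntry_rows]
  · rw [if_neg (mt hmem.1 (not_lt.2 h1)), h3, rowsEntry_rows]

/-- A map of letters realizing the inner tableau translation on all words whose subword of small
letters is a given word with insertion tableau `R`. -/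
theorem exists_map_translation {hk : k ≤ n} {R R' : SYT k} (hsh : R.shape = R'.shape)
    {u : List ℕ} (hu : R.rows = insertionTableau u) :
    ∃ f : ℕ → ℕ, (∀ x, k < x → f x = x) ∧ (∀ x ≤ k, f x ≤ k) ∧
      ∀ (T : WithInner hk R) (w : List ℕ), T.1.rows = insertionTableau w →
        w.filter (· ≤ k) = u →
        (innerTranslation hsh T).1.rows = insertionTableau (w.map f) := by
  have hust := isStandardWord_of_rows_eq hu
  -- The word `u'`, and with it `f`, depends on `u` and `R'` but not on `T` or `w`, so one map
  -- serves both words of an exchange.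
  obtain ⟨u', hlen, hins, hpre⟩ := exists_insertionTableau_eq hust.1 R'.isTableau_rows
    R'.nodup_flatten_rows (by rw [← hu, map_length_rows_eq hsh])
  have hust' := isStandardWord_of_rows_eq hins.symm
  obtain ⟨f, hf1, hf2, hf3⟩ := exists_map_eq hust.1 hlen (fun x hx => ((hust.2 x).1 hx).2)
    (fun x hx => ((hust'.2 x).1 hx).2)
  refine ⟨f, hf1, hf2, fun T w hT hw => ?_⟩
  have hrep := InnerReplacement.insertionTableau hf1 hf2 w
    (by rw [hw, hf3]; exact fun i => (hpre i).symm)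
  rw [hw, hf3, hins, ← hT, ← hu] at hrep
  have hwst := isStandardWord_of_rows_eq hT
  have hsmall : (w.map f).filter (· ≤ k) = u' := by
    rw [List.filter_map, ← hf3, ← hw]
    congr 1
    apply List.filter_congr
    intro x _
    rcases le_or_gt x k with h | h
    · simp [h, hf2 x h]
    · simp [hf1 x h]
  have hlarge : (w.map f).filter (fun x => !decide (x ≤ k)) =
      w.filter (fun x => !decide (x ≤ k)) := by
    rw [List.filter_map]
    have : w.filter ((fun x => !decide (x ≤ k)) ∘ f) = w.filter (fun x => !decide (x ≤ k)) := by
      apply List.filter_congr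
      intro x _
      rcases le_or_gt x k with h | h
      · simp [h, hf2 x h]
      · simp [hf1 x h]
    rw [this]
    conv_rhs => rw [← List.map_id (w.filter (fun x => !decide (x ≤ k)))]
    apply List.map_congr_left
    intro x hx
    have := List.of_mem_filter hx
    simp at this
    exact hf1 x this
  -- The map permutes the small letters and fixes the large ones, so the new word is standard again.
  have hperm : (w.map f).Perm w := by
    have h1 := List.filter_append_perm (fun x => decide (x ≤ k)) (w.map f)
    have h2 := List.filter_append_perm (fun x => decide (x ≤ k)) w
    rw [hsmall, hlarge] at h1
    rw [hw] at h2
    have h3 : u'.Perm u := (List.perm_ext_iff_of_nodup hust'.1 hust.1).2 fun x => by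
      rw [hust.2, hust'.2]
    exact h1.symm.trans ((h3.append_right _).trans h2)
  have hst' := hwst.perm hperm.symm
  refine rows_replaceInner hsh T (isTableau_insertionTableau hst'.1) (fun x hx => ?_) hrep
  exact ((hst'.2 x).1 ((flatten_insertionTableau_perm _).mem_iff.1 hx)).1

end SYT

namespace SYT

variable {n k : ℕ}

/-! ### Permutations and words -/

theorem isStandardWord_oneLine (ρ : Equiv.Perm (Fin n)) : IsStandardWord n (oneLine ρ) := by
  constructor
  · rw [oneLine, List.nodup_ofFn]
    intro i j h
    exact ρ.injective (Fin.ext (by simpa using h))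
  · intro x
    rw [oneLine, List.mem_ofFn]
    constructor
    · rintro ⟨i, rfl⟩
      exact ⟨by omega, by have := (ρ i).isLt; omega⟩
    · rintro ⟨h1, h2⟩
      refine ⟨ρ.symm ⟨x - 1, by omega⟩, ?_⟩
      simp only [Equiv.apply_symm_apply]
      omega

theorem _root_.IsStandardWord.length_eq {w : List ℕ} (hw : IsStandardWord n w) : w.length = n := by
  have : w.Perm (List.range' 1 n) :=
    (List.perm_ext_iff_of_nodup hw.1 List.nodup_range').2 fun x => by
      rw [hw.2, List.mem_range'_1]
      omega
  simpa using this.length_eq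

theorem exists_oneLine_eq {w : List ℕ} (hw : IsStandardWord n w) :
    ∃ ρ : Equiv.Perm (Fin n), oneLine ρ = w := by
  have hlen := hw.length_eq
  have hmem : ∀ i : Fin n, 1 ≤ w[(i : ℕ)] ∧ w[(i : ℕ)] ≤ n := fun i =>
    (hw.2 _).1 (List.getElem_mem _)
  let g : Fin n → Fin n := fun i => ⟨w[(i : ℕ)] - 1, by have := hmem i; omega⟩
  have hg : Function.Injective g := by
    intro i j h
    have h1 := hmem i
    have h2 := hmem j
    have h3 : w[(i : ℕ)] - 1 = w[(j : ℕ)] - 1 := congrArg Fin.val h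
    have h4 : w[(i : ℕ)] = w[(j : ℕ)] := by omega
    exact Fin.ext ((hw.1.getElem_inj_iff).1 h4)
  refine ⟨Equiv.ofBijective g (Finite.injective_iff_bijective.1 hg), ?_⟩
  apply List.ext_getElem
  · simp [oneLine, hlen]
  · intro i h1 h2
    have h3 := hmem ⟨i, hlen ▸ h2⟩
    simp only [oneLine, List.getElem_ofFn, Equiv.ofBijective_apply, g] at h3 ⊢
    omega

theorem oneLine_mul_adjSwap (ρ : Equiv.Perm (Fin n)) (i : ℕ) (h : i + 1 < n) :
    ∃ w v : List ℕ, w.length = i ∧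
      oneLine ρ = w ++ ((ρ ⟨i, by omega⟩ : ℕ) + 1) :: ((ρ ⟨i + 1, h⟩ : ℕ) + 1) :: v ∧
      oneLine (ρ * adjSwap i h) =
        w ++ ((ρ ⟨i + 1, h⟩ : ℕ) + 1) :: ((ρ ⟨i, by omega⟩ : ℕ) + 1) :: v := by
  have key : ∀ L : List ℕ, (hL : L.length = n) →
      L = L.take i ++ L[i] :: L[i + 1] :: L.drop (i + 2) := by
    intro L hL
    rw [List.getElem_cons_drop, List.getElem_cons_drop, List.take_append_drop]
  have hlen : ∀ ρ : Equiv.Perm (Fin n), (oneLine ρ).length = n := fun ρ => by simp [oneLine]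
  have hget : ∀ (ρ : Equiv.Perm (Fin n)) (j : ℕ) (hj : j < (oneLine ρ).length),
      (oneLine ρ)[j] = (ρ ⟨j, hlen ρ ▸ hj⟩ : ℕ) + 1 := fun ρ j hj => by simp [oneLine]
  have hne : ∀ (j : ℕ) (hj : j < n), j ≠ i → j ≠ i + 1 →
      (ρ * adjSwap i h) ⟨j, hj⟩ = ρ ⟨j, hj⟩ := fun j hj h1 h2 => by
    rw [Equiv.Perm.mul_apply, adjSwap, Equiv.swap_apply_of_ne_of_ne] <;> simp [*]
  refine ⟨(oneLine ρ).take i, (oneLine ρ).drop (i + 2), ?_, ?_, ?_⟩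
  · simp [oneLine]
    omega
  · have := key _ (hlen ρ)
    simpa only [hget] using this
  · have h1 := key _ (hlen (ρ * adjSwap i h))
    have h2 : (oneLine (ρ * adjSwap i h)).take i = (oneLine ρ).take i := by
      apply List.ext_getElem (by simp [hlen])
      intro j hj hj'
      have hji : j < i := by simp at hj; omega
      simp only [List.getElem_take, hget]
      rw [hne j _ (by omega) (by omega)]
    have h3 : (oneLine (ρ * adjSwap i h)).drop (i + 2) = (oneLine ρ).drop (i + 2) := by
      apply List.ext_getElem (by simp [hlen])
      intro j hj hj'
      simp only [List.getElem_drop, hget]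
      rw [hne _ _ (by omega) (by omega)]
    rw [h2, h3] at h1
    simpa only [hget, Equiv.Perm.mul_apply, adjSwap, Equiv.swap_apply_left,
      Equiv.swap_apply_right] using h1

/-! ### The length of a permutation -/

/-- The pairs of values that are inverted by a permutation. -/
def inversions (ρ : Equiv.Perm (Fin n)) : Finset (Fin n × Fin n) :=
  Finset.univ.filter fun c => c.1 < c.2 ∧ ρ.symm c.2 < ρ.symm c.1

theorem mem_inversions {ρ : Equiv.Perm (Fin n)} {a b : Fin n} :
    (a, b) ∈ inversions ρ ↔ a < b ∧ ρ.symm b < ρ.symm a := by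
  simp [inversions]

theorem swap_lt_swap_iff {i : ℕ} (h : i + 1 < n) (p q : Fin n)
    (hpq : ¬ ((p : ℕ) = i ∧ (q : ℕ) = i + 1)) (hqp : ¬ ((p : ℕ) = i + 1 ∧ (q : ℕ) = i)) :
    adjSwap i h p < adjSwap i h q ↔ p < q := by
  simp only [adjSwap, Equiv.swap_apply_def, Fin.ext_iff, Fin.lt_def]
  split_ifs <;> simp only <;> omega

/-- Inversions are recorded as pairs of values, so exchanging two adjacent positions only affects
the pair of values that stand there. -/
theorem inversions_mul_adjSwap {ρ : Equiv.Perm (Fin n)} {i : ℕ} (h : i + 1 < n)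
    (hlt : ρ ⟨i, by omega⟩ < ρ ⟨i + 1, h⟩) :
    inversions (ρ * adjSwap i h) =
      insert (ρ ⟨i, by omega⟩, ρ ⟨i + 1, h⟩) (inversions ρ) := by
  have hsymm : ∀ a, (ρ * adjSwap i h).symm a = adjSwap i h (ρ.symm a) := fun a => by
    rw [Equiv.symm_apply_eq]
    simp [adjSwap]
  ext ⟨a, b⟩
  obtain ⟨p, rfl⟩ := ρ.surjective a
  obtain ⟨q, rfl⟩ := ρ.surjective b
  rw [Finset.mem_insert, mem_inversions, mem_inversions, hsymm, hsymm, Equiv.symm_apply_apply,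
    Equiv.symm_apply_apply, Prod.mk.injEq, ρ.injective.eq_iff, ρ.injective.eq_iff]
  by_cases h1 : (p : ℕ) = i ∧ (q : ℕ) = i + 1
  · obtain ⟨rfl, h2⟩ := h1
    obtain rfl : q = ⟨p + 1, h⟩ := Fin.ext h2
    simp [adjSwap, hlt, Fin.lt_def]
  by_cases h2 : (p : ℕ) = i + 1 ∧ (q : ℕ) = i
  · obtain ⟨h3, rfl⟩ := h2
    obtain rfl : p = ⟨q + 1, h⟩ := Fin.ext h3
    have hlt' := not_lt.2 hlt.le
    have hq : ¬ (⟨q + 1, h⟩ : Fin n) = q := by simp [Fin.ext_iff]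
    simp [hlt', hq]
  rw [swap_lt_swap_iff h q p (by tauto) (by tauto)]
  have : ¬ (p = ⟨i, by omega⟩ ∧ q = ⟨i + 1, h⟩) := by
    simpa [Fin.ext_iff] using h1
  tauto

theorem card_inversions_mul_adjSwap {ρ : Equiv.Perm (Fin n)} {i : ℕ} (h : i + 1 < n)
    (hlt : ρ ⟨i, by omega⟩ < ρ ⟨i + 1, h⟩) :
    (inversions (ρ * adjSwap i h)).card = (inversions ρ).card + 1 := by
  rw [inversions_mul_adjSwap h hlt, Finset.card_insert_of_notMem]
  simp [mem_inversions]

theorem adjSwap_mul_self (i : ℕ) (h : i + 1 < n) : adjSwap i h * adjSwap i h = 1 :=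
  Equiv.swap_mul_self _ _

theorem card_inversions_mul_adjSwap_of_gt {ρ : Equiv.Perm (Fin n)} {i : ℕ} (h : i + 1 < n)
    (hlt : ρ ⟨i + 1, h⟩ < ρ ⟨i, by omega⟩) :
    (inversions (ρ * adjSwap i h)).card + 1 = (inversions ρ).card := by
  have := card_inversions_mul_adjSwap (ρ := ρ * adjSwap i h) h
    (by simpa [adjSwap] using hlt)
  rw [mul_assoc, adjSwap_mul_self, mul_one] at this
  exact this.symm

theorem eq_one_of_forall_lt {ρ : Equiv.Perm (Fin n)}
    (h : ∀ (i : ℕ) (h : i + 1 < n), ρ ⟨i, by omega⟩ < ρ ⟨i + 1, h⟩) : ρ = 1 := by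
  cases n with
  | zero => exact Subsingleton.elim _ _
  | succ n =>
    have hmono : StrictMono ρ := Fin.strictMono_iff_lt_succ.2 fun i => h i (by omega)
    have : ρ = Equiv.refl _ := by
      have := Subsingleton.elim (hmono.orderIsoOfSurjective ρ ρ.surjective) (OrderIso.refl _)
      ext x
      exact congrArg (fun e : Fin (n + 1) ≃o Fin (n + 1) => (e x : ℕ)) this
    exact this

theorem inversions_one : inversions (1 : Equiv.Perm (Fin n)) = ∅ := by
  apply Finset.eq_empty_of_forall_notMem
  rintro ⟨a, b⟩ hab
  rw [mem_inversions] at hab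
  exact lt_asymm hab.1 hab.2

/-- Sort the permutation by undoing a descent at a time; each removes one inversion, and only the
identity has no descent. -/
theorem exists_prod_eq (ρ : Equiv.Perm (Fin n)) : ∃ l : List (Equiv.Perm (Fin n)),
    (∀ s ∈ l, ∃ (i : ℕ) (h : i + 1 < n), s = adjSwap i h) ∧ l.prod = ρ ∧
      l.length = (inversions ρ).card := by
  induction hm : (inversions ρ).card generalizing ρ with
  | zero =>
    refine ⟨[], by simp, ?_, rfl⟩
    refine (eq_one_of_forall_lt fun i h => ?_).symm
    by_contra hlt
    have hne : ρ ⟨i, by omega⟩ ≠ ρ ⟨i + 1, h⟩ := fun h => by simpa using ρ.injective h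
    have := card_inversions_mul_adjSwap_of_gt h (lt_of_le_of_ne (not_lt.1 hlt) hne.symm)
    omega
  | succ m ih =>
    by_cases hd : ∃ (i : ℕ) (h : i + 1 < n), ρ ⟨i + 1, h⟩ < ρ ⟨i, by omega⟩
    · obtain ⟨i, h, hlt⟩ := hd
      have := card_inversions_mul_adjSwap_of_gt h hlt
      obtain ⟨l, hl, hprod, hlen⟩ := ih (ρ * adjSwap i h) (by omega)
      refine ⟨l ++ [adjSwap i h], ?_, ?_, by simpa using hlen⟩
      · intro s hs
        rcases List.mem_append.1 hs with hs | hs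
        · exact hl s hs
        · exact ⟨i, h, by simpa using hs⟩
      · rw [List.prod_append, hprod, List.prod_singleton, mul_assoc, adjSwap_mul_self, mul_one]
    · push Not at hd
      have : ρ = 1 := eq_one_of_forall_lt fun i h => by
        refine lt_of_le_of_ne (hd i h) fun h => by simpa using ρ.injective h
      subst this
      simp [inversions_one] at hm

theorem card_inversions_prod_le {l : List (Equiv.Perm (Fin n))}
    (hl : ∀ s ∈ l, ∃ (i : ℕ) (h : i + 1 < n), s = adjSwap i h) :
    (inversions l.prod).card ≤ l.length := by
  induction l using List.reverseRecOn with
  | nil => simp [inversions_one]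
  | append_singleton l s ih =>
    have ih := ih fun s hs => hl s (by simp [hs])
    obtain ⟨i, h, rfl⟩ := hl s (by simp)
    rw [List.prod_append, List.prod_singleton, List.length_append, List.length_singleton]
    rcases lt_or_ge (l.prod ⟨i, by omega⟩) (l.prod ⟨i + 1, h⟩) with hlt | hlt
    · have := card_inversions_mul_adjSwap h hlt
      omega
    · have hne : l.prod ⟨i, by omega⟩ ≠ l.prod ⟨i + 1, h⟩ := fun h => by
        simpa using l.prod.injective h
      have := card_inversions_mul_adjSwap_of_gt h (lt_of_le_of_ne hlt hne.symm)
      omega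

theorem permLength_eq (ρ : Equiv.Perm (Fin n)) : permLength ρ = (inversions ρ).card := by
  obtain ⟨l, hl, hprod, hlen⟩ := exists_prod_eq ρ
  unfold permLength
  apply le_antisymm
  · exact Nat.sInf_le ⟨l, hl, hprod, hlen⟩
  · refine le_csInf ⟨l.length, l, hl, hprod, rfl⟩ ?_
    rintro m ⟨l, hl, rfl, rfl⟩
    exact card_inversions_prod_le hl

theorem permLength_mul_adjSwap_iff {ρ : Equiv.Perm (Fin n)} {i : ℕ} (h : i + 1 < n) :
    permLength (ρ * adjSwap i h) = permLength ρ + 1 ↔ ρ ⟨i, by omega⟩ < ρ ⟨i + 1, h⟩ := by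
  rw [permLength_eq, permLength_eq]
  refine ⟨fun hlen => ?_, card_inversions_mul_adjSwap h⟩
  by_contra hlt
  have hne : ρ ⟨i, by omega⟩ ≠ ρ ⟨i + 1, h⟩ := fun h => by simpa using ρ.injective h
  have := card_inversions_mul_adjSwap_of_gt h (lt_of_le_of_ne (not_lt.1 hlt) hne.symm)
  omega

/-! ### The weak order in terms of words -/

/-- The relation between tableaux generating the weak order: some word in the Knuth class of the
second one is obtained by exchanging two adjacent increasing letters of some word in the Knuth
class of the first one. -/
def WordStep (S T : SYT n) : Prop :=
  ∃ (w v : List ℕ) (a b : ℕ), a < b ∧ S.rows = insertionTableau (w ++ a :: b :: v) ∧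
    T.rows = insertionTableau (w ++ b :: a :: v)

theorem WordStep.le {S T : SYT n} (h : WordStep S T) : S ≤ T := by
  obtain ⟨w, v, a, b, hab, hS, hT⟩ := h
  obtain ⟨ρ, hρ⟩ := exists_oneLine_eq (isStandardWord_of_rows_eq hS)
  have hlen : w.length + 1 < n := by
    have := congrArg List.length hρ
    simp [oneLine] at this
    omega
  obtain ⟨w', v', hw', h1, h2⟩ := oneLine_mul_adjSwap ρ w.length hlen
  rw [hρ] at h1
  obtain ⟨rfl, h3⟩ := List.append_inj h1 hw'.symm
  simp only [List.cons.injEq] at h3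
  obtain ⟨ha, hb, rfl⟩ := h3
  rw [← ha, ← hb] at h2
  refine Relation.ReflTransGen.single ⟨ρ, ?_, ρ * adjSwap w.length hlen, ?_,
    Relation.ReflTransGen.single ⟨w.length, hlen, rfl, ?_⟩⟩
  · change insertionTableau (oneLine ρ) = S.rows
    rw [hρ, hS]
  · change insertionTableau (oneLine _) = T.rows
    rw [h2, hT]
  · rw [permLength_mul_adjSwap_iff, Fin.lt_def]
    omega

theorem le_iff {S T : SYT n} : S ≤ T ↔ Relation.ReflTransGen WordStep S T := by
  constructor
  · intro h
    induction h with
    | refl => exact .refl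
    | tail _ h ih =>
      refine ih.trans ?_
      obtain ⟨σ, hσ, τ, hτ, hle⟩ := h
      rename_i P Q _
      clear ih
      induction hle generalizing Q with
      | refl =>
        have : P = Q := rows_injective ((show _ = P.rows from hσ).symm.trans hτ)
        rw [this]
      | tail _ h ih =>
        rename_i ρ ρ' _
        -- Every permutation on a chain of the right weak order has an insertion tableau, so the
        -- chain breaks up into single exchanges between tableaux.
        obtain ⟨U, hU⟩ := exists_rows_eq_insertionTableau (isStandardWord_oneLine ρ)
        refine (ih hU.symm).tail ?_
        obtain ⟨i, h, rfl, hlen⟩ := h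
        rw [permLength_mul_adjSwap_iff] at hlen
        obtain ⟨w, v, -, h1, h2⟩ := oneLine_mul_adjSwap ρ i h
        refine ⟨w, v, _, _, Nat.succ_lt_succ hlen, by rw [hU, h1], ?_⟩
        rw [← show _ = Q.rows from hτ, h2]
  · intro h
    induction h with
    | refl => exact Relation.ReflTransGen.refl
    | tail _ h ih => exact Relation.ReflTransGen.trans ih h.le

end SYT

/-! ### Monotone quantities and convexity of the fibres of the inner tableau -/

theorem List.Pairwise.eq_of_mem_iff_of_lt {r s : List ℕ} (hr : r.Pairwise (· < ·))
    (hs : s.Pairwise (· < ·)) (h : ∀ x, x ∈ r ↔ x ∈ s) : r = s :=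
  ((List.perm_ext_iff_of_nodup (hr.imp fun h => h.ne) (hs.imp fun h => h.ne)).2 h).eq_of_pairwise
    (fun _ _ _ _ h h' => absurd h' (lt_asymm h)) hr hs

theorem mem_iff_countLT {r : List ℕ} {x : ℕ} : x ∈ r ↔ countLT r x < countLT r (x + 1) := by
  constructor
  · exact fun h => countLT_succ_le r h (Nat.lt_succ_self x)
  · intro h
    by_contra hx
    refine h.ne (List.countP_congr fun y hy => ?_)
    have : y ≠ x := fun h => hx (h ▸ hy)
    simp only [decide_eq_true_eq]
    omega

/-- A letter above `k` does not change the counts below any `e ≤ k + 1`, and `e = k + 1` counts all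
small entries of the first row. -/
theorem firstRowCount_filter {k e : ℕ} (he : e ≤ k + 1) (w : List ℕ) :
    firstRowCount (w.filter (· ≤ k)) e = firstRowCount w e := by
  induction w using List.reverseRecOn generalizing e with
  | nil => rfl
  | append_singleton w x ih =>
    rw [firstRowCount_concat]
    rcases le_or_gt x k with hx | hx
    · rw [List.filter_append, List.filter_singleton]
      simp only [hx, decide_true]
      rw [cond_true, firstRowCount_concat, ih he, ih (by omega)]
    · rw [List.filter_append, List.filter_singleton]
      simp only [not_le.2 hx, decide_false]
      rw [cond_false, List.append_nil, ih he, if_pos (by omega)]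

theorem hasDecreasing_filter {m k : ℕ} {w : List ℕ} :
    HasDecreasing m k (w.filter (· ≤ k)) ↔ HasDecreasing m k w := by
  constructor
  · rintro ⟨s, hs, h⟩
    exact ⟨s, hs.trans List.filter_sublist, h⟩
  · rintro ⟨s, hs, h1, h2, h3⟩
    refine ⟨s, ?_, h1, h2, h3⟩
    have := hs.filter (· ≤ k)
    rwa [List.filter_eq_self.2 (by simpa using h3)] at this

namespace SYT

variable {n k : ℕ}

theorem countLT_inner {T : SYT n} {w : List ℕ} (h : T.rows = insertionTableau w) (hk : k ≤ n)
    {e : ℕ} (he : e ≤ k + 1) :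
    countLT ((T.inner k hk).rows.headD []) e = firstRowCount w e := by
  rw [rows_inner h hk]
  exact firstRowCount_filter he w

theorem two_lt_numRows_inner_iff {T : SYT n} {w : List ℕ} (h : T.rows = insertionTableau w)
    (hk : k ≤ n) : 2 < (T.inner k hk).numRows ↔ HasDecreasing 3 k w := by
  have hr := rows_inner h hk
  rw [← hasDecreasing_filter, hasDecreasing_three_iff ((isStandardWord_of_rows_eq h).1.filter _),
    ← hr, numRows, ← length_rows]
  constructor
  · intro hlen
    have hmem : (T.inner k hk).rows[2] ∈ (T.inner k hk).rows := List.getElem_mem hlen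
    obtain ⟨x, hx⟩ := List.exists_mem_of_ne_nil _ ((T.inner k hk).isTableau_rows.ne_nil _ hmem)
    refine ⟨x, List.mem_flatten.2 ⟨_, List.mem_iff_getElem.2 ⟨0, by simpa using hlen, ?_⟩, hx⟩, ?_⟩
    · simp
    · exact ((T.inner k hk).mem_flatten_rows.1 (List.mem_flatten.2 ⟨_, hmem, hx⟩)).2
  · rintro ⟨x, hx, -⟩
    by_contra hlen
    rw [List.drop_eq_nil_of_le (not_lt.1 hlen)] at hx
    simp at hx

/-- A standard Young tableau with at most two rows is determined by the part of its first row. -/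
theorem eq_of_numRows_le_two {P R : SYT k} (hP : P.numRows ≤ 2) (hR : R.numRows ≤ 2)
    (h : ∀ e ≤ k + 1, countLT (P.rows.headD []) e = countLT (R.rows.headD []) e) : P = R := by
  have hle : ∀ (T : SYT k), ∀ x ∈ T.rows.headD [], x ≤ k := fun T x hx => by
    refine (T.mem_flatten_rows.1 ?_).2
    cases hT : T.rows with
    | nil => simp [hT] at hx
    | cons r L =>
      rw [hT] at hx
      exact List.mem_append_left _ hx
  have hhead : P.rows.headD [] = R.rows.headD [] := by
    have hsort : ∀ T : SYT k, (T.rows.headD []).Pairwise (· < ·) := fun T => by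
      have := T.isTableau_rows.pairwise_lt
      cases hT : T.rows with
      | nil => simp
      | cons r L => exact this r (by simp [hT])
    refine (hsort P).eq_of_mem_iff_of_lt (hsort R) fun x => ?_
    rcases le_or_gt x k with hx | hx
    · rw [mem_iff_countLT, mem_iff_countLT, h x (by omega), h (x + 1) (by omega)]
    · exact ⟨fun h => absurd (hle P x h) (not_le.2 hx), fun h => absurd (hle R x h) (not_le.2 hx)⟩
  -- Flattening the tail describes the second row uniformly, also if it is absent.
  have hform : ∀ {T : SYT k}, T.numRows ≤ 2 → ∀ i, T.rows.getD i [] =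
      if i = 0 then T.rows.headD [] else if i = 1 then
        T.rows.tail.flatten else [] := by
    intro T hT i
    rw [numRows, ← length_rows] at hT
    match T.rows, hT with
    | [], _ => simp
    | [a], _ => rcases i with - | - | i <;> simp
    | [a, b], _ => rcases i with - | - | i <;> simp
  have htail : P.rows.tail.flatten = R.rows.tail.flatten := by
    have hmem : ∀ (T : SYT k) (x : ℕ), x ∈ T.rows.tail.flatten ↔
        (1 ≤ x ∧ x ≤ k) ∧ x ∉ T.rows.headD [] := fun T x => by
      rw [← T.mem_flatten_rows]
      have hnd := T.nodup_flatten_rows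
      cases hT : T.rows with
      | nil => simp
      | cons r L =>
        rw [hT, List.flatten_cons] at hnd
        rw [List.flatten_cons, List.mem_append, List.tail_cons, List.headD_cons]
        exact ⟨fun h => ⟨Or.inr h, fun h' => List.disjoint_of_nodup_append hnd h' h⟩,
          fun h => h.1.resolve_left h.2⟩
    have hsort : ∀ {T : SYT k}, T.numRows ≤ 2 → (T.rows.tail.flatten).Pairwise (· < ·) :=
      fun {T} hT => by
        have := (T.isTableau_rows.getD 1).1
        rwa [hform hT 1] at this
    refine (hsort hP).eq_of_mem_iff_of_lt (hsort hR) fun x => ?_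
    rw [hmem, hmem, hhead]
  refine ext_entry fun i j => ?_
  rw [← rowsEntry_rows, ← rowsEntry_rows, rowsEntry, rowsEntry, hform hP, hform hR, hhead, htail]

/-- A nontrivial chain supplies words for both of its ends, so nonemptiness of Knuth classes is not
needed here. -/
theorem exists_words_of_le {S Q : SYT n} (h : S ≤ Q) (hne : S ≠ Q) :
    ∃ w w' : List ℕ, S.rows = insertionTableau w ∧ Q.rows = insertionTableau w' := by
  rw [le_iff] at h
  obtain ⟨_, ⟨_, _, _, _, _, hS, _⟩, _⟩ := h.cases_head.resolve_left hne
  obtain ⟨_, _, ⟨_, _, _, _, _, _, hQ⟩⟩ := h.cases_tail.resolve_left (Ne.symm hne)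
  exact ⟨_, _, hS, hQ⟩

theorem countLT_headD_le_of_le {S T : SYT n} (h : S ≤ T) (e : ℕ) :
    countLT (T.rows.headD []) e ≤ countLT (S.rows.headD []) e := by
  rw [le_iff] at h
  induction h with
  | refl => exact le_rfl
  | tail _ h ih =>
    obtain ⟨w, v, a, b, hab, h1, h2⟩ := h
    refine le_trans ?_ ih
    rw [h1, h2]
    exact firstRowCount_swap_le w v hab e

theorem two_lt_numRows_inner_of_le {S T : SYT n} (h : S ≤ T) (hk : k ≤ n)
    (hS : 2 < (S.inner k hk).numRows) : 2 < (T.inner k hk).numRows := by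
  rw [le_iff] at h
  induction h with
  | refl => exact hS
  | tail _ h ih =>
    obtain ⟨w, v, a, b, hab, h1, h2⟩ := h
    rw [two_lt_numRows_inner_iff h1 hk] at ih
    rw [two_lt_numRows_inner_iff h2 hk]
    exact ih.swap hab

/-- The set of tableaux with a given inner tableau with at most two rows is convex in the weak
order. -/
theorem inner_eq_of_le_of_le {hk : k ≤ n} {R : SYT k} (hR : R.numRows ≤ 2) {S Q T : SYT n}
    (hS : S.inner k hk = R) (hT : T.inner k hk = R) (hSQ : S ≤ Q) (hQT : Q ≤ T) :
    Q.inner k hk = R := by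
  by_cases h1 : S = Q
  · rw [← h1, hS]
  by_cases h2 : Q = T
  · rw [h2, hT]
  obtain ⟨s, q, hs, hq⟩ := exists_words_of_le hSQ h1
  obtain ⟨_, t, _, ht⟩ := exists_words_of_le hQT h2
  refine eq_of_numRows_le_two ?_ hR fun e he => ?_
  · refine not_lt.1 fun h => ?_
    have := two_lt_numRows_inner_of_le hQT hk h
    rw [hT] at this
    omega
  -- The counts of `Q` lie between those of `T` and `S`, and the latter agree for `e ≤ k + 1`
  -- because both inner tableaux are `R`.
  · have e1 := countLT_headD_le_of_le hSQ e
    have e2 := countLT_headD_le_of_le hQT e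
    have e3 := countLT_inner hs hk he
    have e4 := countLT_inner ht hk he
    rw [countLT_inner hq hk he]
    rw [hS] at e3
    rw [hT] at e4
    rw [hs, hq] at e1
    rw [hq, ht] at e2
    change firstRowCount q e ≤ firstRowCount s e at e1
    change firstRowCount t e ≤ firstRowCount q e at e2
    omega

/-! ### Monotonicity of the inner tableau translation -/

theorem innerTranslation_le_of_large {hk : k ≤ n} {R R' : SYT k} (hsh : R.shape = R'.shape)
    {S T : WithInner hk R} {w v : List ℕ} {a b : ℕ} (hab : a < b) (hb : k < b)
    (hS : S.1.rows = insertionTableau (w ++ a :: b :: v))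
    (hT : T.1.rows = insertionTableau (w ++ b :: a :: v)) :
    (innerTranslation hsh S).1 ≤ (innerTranslation hsh T).1 := by
  -- As `b` is large, the exchange leaves the small subword alone, and the same map of letters
  -- translates both words.
  have hfilter : (w ++ b :: a :: v).filter (· ≤ k) = (w ++ a :: b :: v).filter (· ≤ k) := by
    simp [List.filter_cons, not_le.2 hb]
  have hu := rows_inner hS hk
  rw [S.2] at hu
  obtain ⟨f, hf1, hf2, hf3⟩ := exists_map_translation (hk := hk) hsh hu
  refine WordStep.le ⟨w.map f, v.map f, f a, f b, ?_, ?_, ?_⟩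
  · rw [hf1 b hb]
    rcases le_or_gt a k with ha | ha
    · exact (hf2 a ha).trans_lt hb
    · rwa [hf1 a ha]
  · simpa using hf3 S _ hS rfl
  · simpa using hf3 T _ hT hfilter

theorem innerTranslation_le_of_wordStep {hk : k ≤ n} {R R' : SYT k} (hR : R.numRows ≤ 2)
    (hsh : R.shape = R'.shape) {S T : WithInner hk R} (h : WordStep S.1 T.1) :
    (innerTranslation hsh S).1 ≤ (innerTranslation hsh T).1 := by
  obtain ⟨w, v, a, b, hab, hS, hT⟩ := h
  rcases le_or_gt b k with hbk | hbk
  · have hrow : ∀ e ≤ k + 1, firstRowCount (w ++ a :: b :: v) e =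
        firstRowCount (w ++ b :: a :: v) e := fun e he => by
      rw [← countLT_inner hS hk he, ← countLT_inner hT hk he, S.2, T.2]
    have hdec : ¬ HasDecreasing 3 k (w ++ b :: a :: v) := by
      rw [← two_lt_numRows_inner_iff hT hk, T.2]
      omega
    rcases exists_large_of_swap (isStandardWord_of_rows_eq hS).1 hab hbk hrow hdec with
      h | ⟨w', c, q, v', hc, hq, h1, h2⟩
    · have : S = T := Subtype.ext (rows_injective (by rw [hS, hT, h]))
      rw [this]
      exact Relation.ReflTransGen.refl
    · refine innerTranslation_le_of_large hsh (hc.trans_lt hq) hq (w := w') (v := v') ?_ ?_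
      · rw [hS, h1.insertionTableau_eq]
      · rw [hT, h2.insertionTableau_eq]
  · exact innerTranslation_le_of_large hsh hab hbk hS hT

theorem innerTranslation_le {hk : k ≤ n} {R R' : SYT k} (hR : R.numRows ≤ 2)
    (hsh : R.shape = R'.shape) {S T : WithInner hk R} (h : S.1 ≤ T.1) :
    (innerTranslation hsh S).1 ≤ (innerTranslation hsh T).1 := by
  -- The bound `Q ≤ T.1` is carried along the chain so that convexity keeps each of its members in
  -- the fibre.
  have key : ∀ Q : SYT n, Relation.ReflTransGen WordStep S.1 Q → Q ≤ T.1 →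
      ∃ hQ : Q.inner k hk = R, (innerTranslation hsh S).1 ≤ (innerTranslation hsh ⟨Q, hQ⟩).1 := by
    intro Q hSQ
    induction hSQ with
    | refl => exact fun _ => ⟨S.2, Relation.ReflTransGen.refl⟩
    | tail hSQ hstep ih =>
      intro hQT
      obtain ⟨hP, hle⟩ := ih (Relation.ReflTransGen.trans hstep.le hQT)
      have hQ := inner_eq_of_le_of_le hR S.2 T.2 (le_iff.2 (hSQ.tail hstep)) hQT
      exact ⟨hQ, Relation.ReflTransGen.trans hle (innerTranslation_le_of_wordStep hR hsh
        (S := ⟨_, hP⟩) (T := ⟨_, hQ⟩) hstep)⟩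
  obtain ⟨_, h⟩ := key T.1 (le_iff.1 h) Relation.ReflTransGen.refl
  exact h

/-! ### The inverse translation and strict inequalities -/

theorem innerTranslation_innerTranslation {hk : k ≤ n} {R R' : SYT k} (hsh : R.shape = R'.shape)
    (T : WithInner hk R) : innerTranslation hsh.symm (innerTranslation hsh T) = T := by
  refine Subtype.ext (ext_entry fun i j => ?_)
  change (if (i, j) ∈ R'.shape then R.entry i j else
    if (i, j) ∈ R.shape then R'.entry i j else T.1.entry i j) = T.1.entry i j
  by_cases h : (i, j) ∈ R.shape
  · rw [if_pos (hsh ▸ h)]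
    obtain ⟨T, rfl⟩ := T
    exact if_pos h
  · rw [if_neg (hsh ▸ h), if_neg h]

theorem innerTranslation_injective {hk : k ≤ n} {R R' : SYT k} (hsh : R.shape = R'.shape) :
    Function.Injective (innerTranslation (hk := hk) hsh) :=
  Function.LeftInverse.injective (innerTranslation_innerTranslation hsh)

theorem innerTranslation_lt {hk : k ≤ n} {R R' : SYT k} (hR : R.numRows ≤ 2)
    (hsh : R.shape = R'.shape) {S T : WithInner hk R} (h : S.1 < T.1) :
    (innerTranslation hsh S).1 < (innerTranslation hsh T).1 :=
  ⟨innerTranslation_le hR hsh h.1, fun h' =>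
    h.2 (congrArg Subtype.val (innerTranslation_injective hsh (Subtype.ext h')))⟩

theorem lt_of_innerTranslation_lt {hk : k ≤ n} {R R' : SYT k} (hR : R.numRows ≤ 2)
    (hsh : R.shape = R'.shape) {S : WithInner hk R} {Q : WithInner hk R'}
    (h : (innerTranslation hsh S).1 < Q.1) : S.1 < (innerTranslation hsh.symm Q).1 := by
  have hR' : R'.numRows ≤ 2 := by rwa [numRows, ← hsh]
  have := innerTranslation_lt hR' hsh.symm h
  rwa [innerTranslation_innerTranslation] at this

theorem innerTranslation_lt_of_lt {hk : k ≤ n} {R R' : SYT k} (hR : R.numRows ≤ 2)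
    (hsh : R.shape = R'.shape) {T : WithInner hk R} {Q : WithInner hk R'}
    (h : Q.1 < (innerTranslation hsh T).1) : (innerTranslation hsh.symm Q).1 < T.1 := by
  have hR' : R'.numRows ≤ 2 := by rwa [numRows, ← hsh]
  have := innerTranslation_lt hR' hsh.symm h
  rwa [innerTranslation_innerTranslation] at this

end SYT

theorem mainTheorem1 (n k : ℕ) (hk : k ≤ n) (R R' : SYT k) (hrows : R.numRows = 2)
    (hsh : R.shape = R'.shape) :
    -- covering relations in the subposet of tableaux with inner tableau `R`
    (∀ S T : SYT.WithInner hk R, S ⋖ T →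
      SYT.innerTranslation hsh S ⋖ SYT.innerTranslation hsh T) ∧
    -- covering relations in the whole poset between tableaux with inner tableau `R`
    (∀ S T : SYT.WithInner hk R, (S : SYT n) ⋖ (T : SYT n) →
      (SYT.innerTranslation hsh S : SYT n) ⋖ (SYT.innerTranslation hsh T : SYT n)) ∧
    -- the weak order is preserved
    (∀ S T : SYT.WithInner hk R, S ≤ T →
      SYT.innerTranslation hsh S ≤ SYT.innerTranslation hsh T) := by
  have hR : R.numRows ≤ 2 := hrows.le
  have hR' : R'.numRows ≤ 2 := by rwa [SYT.numRows, ← hsh]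
  refine ⟨fun S T h => ⟨SYT.innerTranslation_lt hR hsh h.1, fun Q h1 h2 => ?_⟩,
    fun S T h => ⟨SYT.innerTranslation_lt hR hsh h.1, fun Q h1 h2 => ?_⟩,
    fun S T h => SYT.innerTranslation_le hR hsh h⟩
  · exact h.2 (c := SYT.innerTranslation hsh.symm Q) (SYT.lt_of_innerTranslation_lt hR hsh h1)
      (SYT.innerTranslation_lt_of_lt hR hsh h2)
  -- Here `Q` is an arbitrary tableau; convexity puts it in the fibre over `R'`, from which it can
  -- be translated back.
  · have hQ : Q.inner k hk = R' := SYT.inner_eq_of_le_of_le hR'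
      (SYT.innerTranslation hsh S).2 (SYT.innerTranslation hsh T).2 h1.1 h2.1
    exact h.2 (SYT.lt_of_innerTranslation_lt hR hsh (Q := ⟨Q, hQ⟩) h1)
      (SYT.innerTranslation_lt_of_lt hR hsh (Q := ⟨Q, hQ⟩) h2)
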